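/- Let $\psi:\mathbb R\to\mathbb C$ be a wavelet, i.e. $\int(1+|t|)\,|\psi(t)|\,dt<\infty$, $\int\psi(t)\,dt=0$, $\int|\psi(t)|^2dt=1$, and the Fourier transform $\widehat\psi(\omega)=\int\psi(t)e^{-i\omega t}dt$ is real-valued. For $j\in\mathbb Z$ put $\psi_j(t)=2^{-j}\psi(2^{-j}t)$. Let $X=(X(t))_{t\in\mathbb R}$ be a real-valued, jointly measurable random process whose increments have finite second moments and are stationary: for every $s\in\mathbb R$ the processes $(X(t+s)-X(s))_{t}$ and $(X(t)-X(0))_{t}$ have the same finite-dimensional distributions. Let $\sigma_W(j)=\mathbb E\{|X\star\psi_j(t)|^2\}^{1/2}$ and, for $j,a,b\in\mathbb Z$, define the scattering cross-spectrum $$C_S(j,a,b)=\frac{\mathbb E\big\{\,|X\star\psi_j|\star\psi_{j-b}(t)\;\big(|X\star\psi_{j-a}|\star\psi_{j-b}(t)\big)^*\big\}}{\sigma_W(j)\,\sigma_W(j-a)}$$ (with $C_S(j,a,b)=0$ when the denominator is $0$), the expectations being taken at an arbitrary fixed time $t\in\mathbb R$. Then, for all $j,k\in\mathbb Z$ and $t\in\mathbb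 R$, the convolutions defining $X\star\psi_j(t)$ and $|X\star\psi_j|\star\psi_k(t)$ converge absolutely almost surely and have finite second moments, and, for every choice of $t$: 1. If $\psi$ is analytic, i.e. $\widehat\psi(\omega)=0$ for all $\omega<0$, if $X$ is a Gaussian process, and if $j,a\in\mathbb Z$ are such that $\widehat\psi_j(\omega)\,\widehat\psi_{j-a}(\omega)=0$ for all $\omega\in\mathbb R$, then $C_S(j,a,b)=0$ for all $b\in\mathbb Z$. 2. If $X$ is time-reversible, i.e. $(X(-t))_{t}$ and $(X(t))_{t}$ have the same finite-dimensional distributions, then $\operatorname{Im}C_S(j,a,b)=0$ for all $j,a,b\in\mathbb Z$. -/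

import Mathlib

open MeasureTheory ProbabilityTheory
open scoped Convolution ComplexConjugate

namespace Scattering

noncomputable section

/-- The Fourier transform with the angular-frequency convention
`f̂(ω) = ∫ f(t) e^{-iωt} dt`. -/
def angularFourier (f : ℝ → ℂ) (ω : ℝ) : ℂ :=
  ∫ t : ℝ, f t * Complex.exp (-(Complex.I * (ω : ℂ) * (t : ℂ)))

/-- A complex wavelet. The field `decay` makes precise how fast the wavelet decays: it has a finite
first absolute moment, so that it can be convolved with processes that grow linearly. -/
structure IsWavelet (ψ : ℝ → ℂ) : Prop where
  measurable : Measurable ψ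
  decay : Integrable (fun t : ℝ => (1 + |t|) * ‖ψ t‖)
  zero_average : ∫ t : ℝ, ψ t = 0
  unit_energy : ∫ t : ℝ, ‖ψ t‖ ^ 2 = 1
  real_fourier : ∀ ω : ℝ, (angularFourier ψ ω).im = 0

/-- The Fourier transform of `ψ` is carried by the nonnegative frequencies. -/
def IsAnalyticWavelet (ψ : ℝ → ℂ) : Prop :=
  ∀ ω : ℝ, ω < 0 → angularFourier ψ ω = 0

/-- The dilated wavelet `ψ_j(t) = 2^{-j} ψ(2^{-j} t)`. -/
def dilate (ψ : ℝ → ℂ) (j : ℤ) (t : ℝ) : ℂ :=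
  ((2 : ℝ) ^ (-j) : ℝ) * ψ ((2 : ℝ) ^ (-j) * t)

/-- The wavelet transform `W x(t, j) = x ⋆ ψ_j (t)` of a real signal. -/
def waveletTransform (ψ : ℝ → ℂ) (x : ℝ → ℝ) (j : ℤ) (t : ℝ) : ℂ :=
  (x ⋆ dilate ψ j) t

/-- The modulus `|x ⋆ ψ_j|`, as a real signal. -/
def waveletModulus (ψ : ℝ → ℂ) (x : ℝ → ℝ) (j : ℤ) (t : ℝ) : ℝ :=
  ‖waveletTransform ψ x j t‖

/-- The scattering transform `S x(t; j, k) = |x ⋆ ψ_j| ⋆ ψ_k (t)`. -/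
def scatteringTransform (ψ : ℝ → ℂ) (x : ℝ → ℝ) (j k : ℤ) (t : ℝ) : ℂ :=
  waveletTransform ψ (waveletModulus ψ x j) k t

variable {Ω : Type*} [MeasurableSpace Ω]

/-- `σ_W(j) = E{|X ⋆ ψ_j(t)|²}^{1/2}`, computed at time `t`. -/
def waveletSigma (ψ : ℝ → ℂ) (X : ℝ → Ω → ℝ) (P : Measure Ω) (j : ℤ) (t : ℝ) : ℝ :=
  Real.sqrt (∫ ω, ‖waveletTransform ψ (fun u => X u ω) j t‖ ^ 2 ∂P)

/-- The scattering cross-spectrum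
`C_S(j,a,b) = E{|X ⋆ ψ_j| ⋆ ψ_{j-b}(t) (|X ⋆ ψ_{j-a}| ⋆ ψ_{j-b}(t))^*} / (σ_W(j) σ_W(j-a))`,
computed at time `t`. -/
def crossSpectrum (ψ : ℝ → ℂ) (X : ℝ → Ω → ℝ) (P : Measure Ω) (j a b : ℤ) (t : ℝ) : ℂ :=
  (∫ ω, scatteringTransform ψ (fun u => X u ω) j (j - b) t *
      conj (scatteringTransform ψ (fun u => X u ω) (j - a) (j - b) t) ∂P) /
    ((waveletSigma ψ X P j t * waveletSigma ψ X P (j - a) t : ℝ) : ℂ)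

/-- The increments of `X` are (strictly) stationary: the finite-dimensional distributions of
`(X(t + s) - X(s))_t` do not depend on `s`. -/
def HasStationaryIncrements (X : ℝ → Ω → ℝ) (P : Measure Ω) : Prop :=
  ∀ s : ℝ, IdentDistrib (fun ω (t : ℝ) => X (t + s) ω - X s ω)
    (fun ω (t : ℝ) => X t ω - X 0 ω) P P

/-- `X` and its time reversal `t ↦ X(-t)` have the same distribution. -/
def IsTimeReversible (X : ℝ → Ω → ℝ) (P : Measure Ω) : Prop :=
  IdentDistrib (fun ω (t : ℝ) => X (-t) ω) (fun ω (t : ℝ) => X t ω) P P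

/-- The convolutions defining `X ⋆ ψ_j(t)` and `|X ⋆ ψ_j| ⋆ ψ_k(t)` converge absolutely almost
surely, and the resulting random variables have finite second moments. -/
def IsWellDefined (ψ : ℝ → ℂ) (X : ℝ → Ω → ℝ) (P : Measure Ω) : Prop :=
  (∀ (j : ℤ) (t : ℝ),
    (∀ᵐ ω ∂P, ConvolutionExistsAt (fun u => X u ω) (dilate ψ j) t
      (ContinuousLinearMap.lsmul ℝ ℝ) volume) ∧
    MemLp (fun ω => waveletTransform ψ (fun u => X u ω) j t) 2 P) ∧
  (∀ (j k : ℤ) (t : ℝ),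
    (∀ᵐ ω ∂P, ConvolutionExistsAt (waveletModulus ψ (fun u => X u ω) j) (dilate ψ k) t
      (ContinuousLinearMap.lsmul ℝ ℝ) volume) ∧
    MemLp (fun ω => scatteringTransform ψ (fun u => X u ω) j k t) 2 P)

end

end Scattering

/-!
Path integrals are almost sure limits of averages over independently sampled times, so the law of a
process determines the law of its convolutions, and convolutions of Gaussian processes are Gaussian.
By stationarity `t ↦ ‖X t - X 0‖` is a seminorm on `ℝ` for the `L²` norm; being measurable, it grows
at most linearly, which a filter with a first moment can integrate.

In the Gaussian case, if two mean-zero filters have disjoint spectra, then the corresponding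
filtered processes have zero cross-covariance; as the spectra of analytic filters are also disjoint
from each other's reflections, the pseudo-covariance vanishes too. The filtered processes are thus
independent, so that the second moment factors, and the stationary modulus has a constant mean,
which the next mean-zero filter kills.

In the reversible case, `f̂` real means `f (-t) = conj (f t)`, so reversing time about `t`
conjugates the scattering coefficients at `t` while preserving their joint law. Cross moments
therefore equal their conjugates.
-/

open Set Filter Topology
open scoped ENNReal NNReal

namespace Scattering

section PathIntegral

variable {T T' Ω E F : Type*} [MeasurableSpace T] [MeasurableSpace T'] [MeasurableSpace Ω]
  {μ : Measure T} {ν : Measure T'} {P : Measure Ω} [NormedAddCommGroup E] [NormedAddCommGroup F]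

lemma lintegral_enorm_mul_enorm_le {f : Ω → E} {g : Ω → F} (hf : AEStronglyMeasurable f P)
    (hg : AEStronglyMeasurable g P) :
    ∫⁻ ω, ‖f ω‖ₑ * ‖g ω‖ₑ ∂P ≤ eLpNorm f 2 P * eLpNorm g 2 P := by
  simpa [eLpNorm_eq_lintegral_rpow_enorm_toReal] using
    ENNReal.lintegral_mul_le_Lp_mul_Lq P Real.HolderConjugate.two_two hf.enorm hg.enorm

lemma eLpNorm_two_sq {ε : Type*} [TopologicalSpace ε] [ContinuousENorm ε] (f : Ω → ε) :
    eLpNorm f 2 P ^ 2 = ∫⁻ ω, ‖f ω‖ₑ ^ 2 ∂P := by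
  simpa using eLpNorm_nnreal_pow_eq_lintegral (f := f) (μ := P) (p := 2) two_ne_zero

/-- A jointly measurable process `X` whose `L²(P)` norms are `μ`-integrable. This is the condition
under which the path integrals `∫ X s ω ∂μ(s)` converge almost surely and in `L²(P)`. -/
structure IsL2Integrable (X : T → Ω → E) (μ : Measure T) (P : Measure Ω) : Prop where
  stronglyMeasurable : StronglyMeasurable (Function.uncurry X)
  lintegral_eLpNorm_lt_top : ∫⁻ s, eLpNorm (X s) 2 P ∂μ < ∞

lemma measurable_eLpNorm_two [SFinite P] {X : T → Ω → E}
    (hX : StronglyMeasurable (Function.uncurry X)) : Measurable fun s => eLpNorm (X s) 2 P := by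
  simp only [eLpNorm_eq_lintegral_rpow_enorm_toReal two_ne_zero ENNReal.ofNat_ne_top]
  exact ((hX.enorm.pow_const _).lintegral_prod_right').pow_const _

namespace IsL2Integrable

variable {X : T → Ω → E} {Y : T' → Ω → F}

lemma stronglyMeasurable_eval (hX : IsL2Integrable X μ P) (s : T) : StronglyMeasurable (X s) :=
  hX.stronglyMeasurable.comp_measurable measurable_prodMk_left

lemma stronglyMeasurable_path (hX : IsL2Integrable X μ P) (ω : Ω) :
    StronglyMeasurable fun s => X s ω :=
  hX.stronglyMeasurable.comp_measurable measurable_prodMk_right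

lemma measurable_lintegral [SFinite μ] (hX : IsL2Integrable X μ P) :
    Measurable fun ω => ∫⁻ s, ‖X s ω‖ₑ ∂μ :=
  hX.stronglyMeasurable.enorm.lintegral_prod_left'

lemma stronglyMeasurable_integral [NormedSpace ℝ E] [SFinite μ] (hX : IsL2Integrable X μ P) :
    StronglyMeasurable fun ω => ∫ s, X s ω ∂μ :=
  hX.stronglyMeasurable.integral_prod_left

lemma lintegral_prod_enorm_mul_enorm_le [SFinite μ] [SFinite ν] [SFinite P]
    (hX : IsL2Integrable X μ P) (hY : IsL2Integrable Y ν P) :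
    ∫⁻ z, ∫⁻ ω, ‖X z.1 ω‖ₑ * ‖Y z.2 ω‖ₑ ∂P ∂μ.prod ν ≤
      (∫⁻ s, eLpNorm (X s) 2 P ∂μ) * ∫⁻ r, eLpNorm (Y r) 2 P ∂ν := by
  rw [← lintegral_prod_mul (measurable_eLpNorm_two hX.stronglyMeasurable).aemeasurable
    (measurable_eLpNorm_two hY.stronglyMeasurable).aemeasurable]
  exact lintegral_mono fun z => lintegral_enorm_mul_enorm_le
    (hX.stronglyMeasurable_eval _).aestronglyMeasurable
    (hY.stronglyMeasurable_eval _).aestronglyMeasurable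

lemma lintegral_lintegral_mul_lintegral_le [SFinite μ] [SFinite ν] [SFinite P]
    (hX : IsL2Integrable X μ P) (hY : IsL2Integrable Y ν P) :
    ∫⁻ ω, (∫⁻ s, ‖X s ω‖ₑ ∂μ) * ∫⁻ r, ‖Y r ω‖ₑ ∂ν ∂P ≤
      (∫⁻ s, eLpNorm (X s) 2 P ∂μ) * ∫⁻ r, eLpNorm (Y r) 2 P ∂ν := by
  refine le_of_eq_of_le ?_ (hX.lintegral_prod_enorm_mul_enorm_le hY)
  have hX' : Measurable fun p : Ω × T × T' => ‖X p.2.1 p.1‖ₑ :=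
    hX.stronglyMeasurable.enorm.comp (by fun_prop : Measurable fun p : Ω × T × T' => (p.2.1, p.1))
  have hY' : Measurable fun p : Ω × T × T' => ‖Y p.2.2 p.1‖ₑ :=
    hY.stronglyMeasurable.enorm.comp (by fun_prop : Measurable fun p : Ω × T × T' => (p.2.2, p.1))
  rw [← lintegral_lintegral_swap (hX'.mul hY').aemeasurable]
  exact lintegral_congr fun ω => (lintegral_prod_mul
    (hX.stronglyMeasurable_path ω).enorm.aemeasurable
    (hY.stronglyMeasurable_path ω).enorm.aemeasurable).symm

lemma eLpNorm_lintegral_le [SFinite μ] [SFinite P] (hX : IsL2Integrable X μ P) :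
    eLpNorm (fun ω => ∫⁻ s, ‖X s ω‖ₑ ∂μ) 2 P ≤ ∫⁻ s, eLpNorm (X s) 2 P ∂μ := by
  rw [← ENNReal.pow_le_pow_left_iff two_ne_zero, eLpNorm_two_sq]
  simpa only [enorm_eq_self, sq] using hX.lintegral_lintegral_mul_lintegral_le hX

lemma ae_integrable [SFinite μ] [SFinite P] (hX : IsL2Integrable X μ P) :
    ∀ᵐ ω ∂P, Integrable (fun s => X s ω) μ := by
  have hfin : ∫⁻ ω, (∫⁻ s, ‖X s ω‖ₑ ∂μ) ^ 2 ∂P < ∞ := by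
    simp only [sq]
    exact (hX.lintegral_lintegral_mul_lintegral_le hX).trans_lt
      (ENNReal.mul_lt_top hX.lintegral_eLpNorm_lt_top hX.lintegral_eLpNorm_lt_top)
  filter_upwards [ae_lt_top (hX.measurable_lintegral.pow_const 2) hfin.ne] with ω hω
  exact ⟨(hX.stronglyMeasurable_path ω).aestronglyMeasurable,
    (ENNReal.pow_lt_top_iff.1 hω).resolve_right two_ne_zero⟩

lemma integrable_uncurry [SFinite μ] [IsProbabilityMeasure P] (hX : IsL2Integrable X μ P) :
    Integrable (Function.uncurry X) (μ.prod P) := by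
  refine ⟨hX.stronglyMeasurable.aestronglyMeasurable, ?_⟩
  rw [hasFiniteIntegral_iff_enorm, lintegral_prod _ hX.stronglyMeasurable.enorm.aemeasurable]
  refine (lintegral_mono fun s => ?_).trans_lt hX.lintegral_eLpNorm_lt_top
  simpa only [eLpNorm_one_eq_lintegral_enorm, Function.uncurry_apply_pair] using
    eLpNorm_le_eLpNorm_of_exponent_le one_le_two
      (hX.stronglyMeasurable_eval s).aestronglyMeasurable

section Integral

variable [NormedSpace ℝ E]

lemma eLpNorm_integral_le [SFinite μ] [SFinite P] (hX : IsL2Integrable X μ P) :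
    eLpNorm (fun ω => ∫ s, X s ω ∂μ) 2 P ≤ ∫⁻ s, eLpNorm (X s) 2 P ∂μ :=
  (eLpNorm_mono_enorm fun ω => by
    simpa only [enorm_eq_self] using enorm_integral_le_lintegral_enorm _).trans
    hX.eLpNorm_lintegral_le

lemma memLp_integral [SFinite μ] [SFinite P] (hX : IsL2Integrable X μ P) :
    MemLp (fun ω => ∫ s, X s ω ∂μ) 2 P :=
  ⟨hX.stronglyMeasurable_integral.aestronglyMeasurable,
    hX.eLpNorm_integral_le.trans_lt hX.lintegral_eLpNorm_lt_top⟩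

lemma integral_integral [SFinite μ] [IsProbabilityMeasure P] (hX : IsL2Integrable X μ P) :
    ∫ ω, ∫ s, X s ω ∂μ ∂P = ∫ s, ∫ ω, X s ω ∂P ∂μ :=
  (integral_integral_swap hX.integrable_uncurry).symm

lemma clm_comp {G : Type*} [NormedAddCommGroup G] [NormedSpace ℝ G] (L : E →L[ℝ] G)
    (hX : IsL2Integrable X μ P) : IsL2Integrable (fun s ω => L (X s ω)) μ P where
  stronglyMeasurable := L.continuous.comp_stronglyMeasurable hX.stronglyMeasurable
  lintegral_eLpNorm_lt_top := by
    calc ∫⁻ s, eLpNorm (fun ω => L (X s ω)) 2 P ∂μ ≤ ∫⁻ s, ‖L‖ₑ * eLpNorm (X s) 2 P ∂μ :=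
          lintegral_mono fun s =>
            (eLpNorm_le_nnreal_smul_eLpNorm_of_ae_le_mul (c := ‖L‖₊)
              (.of_forall fun ω => L.le_opNNNorm _) 2).trans_eq (by rfl)
      _ < ∞ := by
        rw [lintegral_const_mul' _ _ enorm_ne_top]
        exact ENNReal.mul_lt_top enorm_lt_top hX.lintegral_eLpNorm_lt_top

end Integral

section Mul

variable {𝕜 : Type*} [RCLike 𝕜] {X : T → Ω → 𝕜} {Y : T' → Ω → 𝕜}

lemma integrable_mul [SFinite μ] [SFinite ν] [SFinite P] (hX : IsL2Integrable X μ P)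
    (hY : IsL2Integrable Y ν P) :
    Integrable (fun p : (T × T') × Ω => X p.1.1 p.2 * Y p.1.2 p.2) ((μ.prod ν).prod P) := by
  have hmeas : StronglyMeasurable fun p : (T × T') × Ω => X p.1.1 p.2 * Y p.1.2 p.2 :=
    (hX.stronglyMeasurable.comp_measurable
      (by fun_prop : Measurable fun p : (T × T') × Ω => (p.1.1, p.2))).mul
    (hY.stronglyMeasurable.comp_measurable
      (by fun_prop : Measurable fun p : (T × T') × Ω => (p.1.2, p.2)))
  refine ⟨hmeas.aestronglyMeasurable, ?_⟩
  rw [hasFiniteIntegral_iff_enorm, lintegral_prod _ hmeas.enorm.aemeasurable]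
  simp only [enorm_mul]
  exact (hX.lintegral_prod_enorm_mul_enorm_le hY).trans_lt
    (ENNReal.mul_lt_top hX.lintegral_eLpNorm_lt_top hY.lintegral_eLpNorm_lt_top)

lemma integral_mul_integral [SFinite μ] [SFinite ν] [SFinite P] (hX : IsL2Integrable X μ P)
    (hY : IsL2Integrable Y ν P) :
    ∫ ω, (∫ s, X s ω ∂μ) * ∫ r, Y r ω ∂ν ∂P =
      ∫ z, ∫ ω, X z.1 ω * Y z.2 ω ∂P ∂μ.prod ν := by
  rw [integral_integral_swap (hX.integrable_mul hY)]
  exact integral_congr_ae (.of_forall fun ω => (integral_prod_mul _ _).symm)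

end Mul

end IsL2Integrable

end PathIntegral

section MonteCarlo

variable {T Ω E : Type*} [MeasurableSpace T] [MeasurableSpace Ω] {P : Measure Ω}
  [NormedAddCommGroup E] [NormedSpace ℝ E]

/-- The average of `f` over the points `S 0, …, S (n - 1)`, weighted so that it estimates `∫ f ∂μ`
when the points are drawn from the probability measure `μ.toFinite` equivalent to `μ`. -/
noncomputable def monteCarlo (μ : Measure T) [SFinite μ] (S : ℕ → T) (n : ℕ) (f : T → E) : E :=
  (n : ℝ)⁻¹ • ∑ i ∈ Finset.range n, (μ.rnDeriv μ.toFinite (S i)).toReal • f (S i)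

/-- The law of a sequence of independent points drawn from `μ.toFinite`. -/
noncomputable def samplingLaw (μ : Measure T) [SFinite μ] [NeZero μ] : Measure (ℕ → T) :=
  Measure.infinitePi fun _ => μ.toFinite

instance (μ : Measure T) [SFinite μ] [NeZero μ] : IsProbabilityMeasure (samplingLaw μ) :=
  inferInstanceAs (IsProbabilityMeasure (Measure.infinitePi _))

variable {μ : Measure T} [SigmaFinite μ]

lemma ae_tendsto_monteCarlo [NeZero μ] [CompleteSpace E] {f : T → E}
    (hmeas : StronglyMeasurable f) (hf : Integrable f μ) :
    ∀ᵐ S ∂samplingLaw μ, Tendsto (fun n => monteCarlo μ S n f) atTop (𝓝 (∫ s, f s ∂μ)) := by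
  borelize E
  have hac := absolutelyContinuous_toFinite μ
  set g : T → E := fun s => (μ.rnDeriv μ.toFinite s).toReal • f s
  have hg : StronglyMeasurable g :=
    (Measure.measurable_rnDeriv _ _).ennreal_toReal.stronglyMeasurable.smul hmeas
  have hmp (i : ℕ) : MeasurePreserving (fun S : ℕ → T => S i) (samplingLaw μ) μ.toFinite :=
    measurePreserving_eval_infinitePi _ i
  have hlaw (i : ℕ) : IdentDistrib (fun S : ℕ → T => g (S i)) g (samplingLaw μ) μ.toFinite :=
    ⟨(hg.measurable.comp (measurable_pi_apply i)).aemeasurable, hg.measurable.aemeasurable, by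
      rw [← (hmp i).map_eq, Measure.map_map hg.measurable (measurable_pi_apply i)]; rfl⟩
  have hint : Integrable g μ.toFinite := (integrable_rnDeriv_smul_iff hac).2 hf
  have hindep : iIndepFun (fun i (S : ℕ → T) => g (S i)) (samplingLaw μ) :=
    iIndepFun_infinitePi fun _ => hg.measurable
  have hslln := strong_law_ae (fun i (S : ℕ → T) => g (S i)) ((hlaw 0).integrable_iff.2 hint)
    (fun i j hij => hindep.indepFun hij) fun i => (hlaw i).trans (hlaw 0).symm
  rwa [(hlaw 0).integral_eq, integral_rnDeriv_smul hac] at hslln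

lemma ae_ae_tendsto_monteCarlo [NeZero μ] [CompleteSpace E] [SFinite P] {X : T → Ω → E}
    (hmeas : StronglyMeasurable (Function.uncurry X))
    (hX : ∀ᵐ ω ∂P, Integrable (fun s => X s ω) μ) :
    ∀ᵐ S ∂samplingLaw μ, ∀ᵐ ω ∂P,
      Tendsto (fun n => monteCarlo μ S n fun s => X s ω) atTop (𝓝 (∫ s, X s ω ∂μ)) := by
  have hterm (n : ℕ) : StronglyMeasurable fun p : (ℕ → T) × Ω =>
      monteCarlo μ p.1 n (fun s => X s p.2) - ∫ s, X s p.2 ∂μ := by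
    refine (StronglyMeasurable.const_smul (Finset.stronglyMeasurable_fun_sum _ fun i _ =>
      StronglyMeasurable.smul ?_ ?_) _).sub
      (hmeas.integral_prod_left.comp_measurable measurable_snd)
    · exact ((Measure.measurable_rnDeriv _ _).ennreal_toReal.comp
        ((measurable_pi_apply i).comp measurable_fst)).stronglyMeasurable
    · exact hmeas.comp_measurable (by fun_prop : Measurable fun p : (ℕ → T) × Ω => (p.1 i, p.2))
  have hset : MeasurableSet {p : (ℕ → T) × Ω | Tendsto
      (fun n => monteCarlo μ p.1 n fun s => X s p.2) atTop (𝓝 (∫ s, X s p.2 ∂μ))} := by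
    simp_rw [tendsto_iff_norm_sub_tendsto_zero (b := ∫ s, X s _ ∂μ)]
    exact measurableSet_tendsto_fun (fun n => (hterm n).norm.measurable) measurable_const
  rw [Measure.ae_ae_comm hset]
  filter_upwards [hX] with ω hω
  exact ae_tendsto_monteCarlo (hmeas.comp_measurable measurable_prodMk_right) hω

end MonteCarlo

section IdentDistrib

variable {T Ω ι E : Type*} [MeasurableSpace T] [MeasurableSpace Ω] {P : Measure Ω}
  {μ : Measure T} [SigmaFinite μ]

lemma identDistrib_monteCarlo [NormedAddCommGroup E] [NormedSpace ℝ E]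
    [MeasurableSpace E] [BorelSpace E] [SecondCountableTopology E] {U V : ι → T → Ω → E}
    (h : IdentDistrib (fun ω (p : ι × T) => U p.1 p.2 ω) (fun ω p => V p.1 p.2 ω) P P)
    (S : ℕ → T) (n : ℕ) :
    IdentDistrib (fun ω i => monteCarlo μ S n fun s => U i s ω)
      (fun ω i => monteCarlo μ S n fun s => V i s ω) P P := by
  refine h.comp (u := fun x i => monteCarlo μ S n fun s => x (i, s)) (measurable_pi_lambda _ ?_)
  intro i
  unfold monteCarlo
  fun_prop

lemma identDistrib_of_ae_tendsto [IsProbabilityMeasure P] [TopologicalSpace E]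
    [TopologicalSpace.PseudoMetrizableSpace E] [MeasurableSpace E] [BorelSpace E]
    {A B : ℕ → Ω → E} {A' B' : Ω → E}
    (h : ∀ n, IdentDistrib (A n) (B n) P P)
    (hA : ∀ᵐ ω ∂P, Tendsto (fun n => A n ω) atTop (𝓝 (A' ω)))
    (hB : ∀ᵐ ω ∂P, Tendsto (fun n => B n ω) atTop (𝓝 (B' ω))) :
    IdentDistrib A' B' P P := by
  have hA' := aemeasurable_of_tendsto_metrizable_ae _ (fun n => (h n).aemeasurable_fst) hA
  have hB' := aemeasurable_of_tendsto_metrizable_ae _ (fun n => (h n).aemeasurable_snd) hB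
  have hlimA := tendstoInDistribution_of_ae_tendsto (fun n => (h n).aemeasurable_fst) hA' hA
  have hlimB := tendstoInDistribution_of_ae_tendsto (fun n => (h n).aemeasurable_snd) hB' hB
  refine ⟨hA', hB', tendstoInDistribution_unique A hlimA ⟨hlimA.forall_aemeasurable, hB', ?_⟩⟩
  simpa only [(h _).map_eq] using hlimB.tendsto

variable [IsProbabilityMeasure P] [NormedAddCommGroup E] [NormedSpace ℝ E] [CompleteSpace E]
  [MeasurableSpace E] [BorelSpace E] [SecondCountableTopology E] {U V : ι → T → Ω → E}

lemma identDistrib_integral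
    (hUm : ∀ i, StronglyMeasurable (Function.uncurry (U i)))
    (hVm : ∀ i, StronglyMeasurable (Function.uncurry (V i)))
    (hU : ∀ i, ∀ᵐ ω ∂P, Integrable (fun s => U i s ω) μ)
    (hV : ∀ i, ∀ᵐ ω ∂P, Integrable (fun s => V i s ω) μ)
    (h : IdentDistrib (fun ω (p : ι × T) => U p.1 p.2 ω) (fun ω p => V p.1 p.2 ω) P P) :
    IdentDistrib (fun ω i => ∫ s, U i s ω ∂μ) (fun ω i => ∫ s, V i s ω ∂μ) P P := by
  rcases eq_zero_or_neZero μ with rfl | _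
  · simpa using IdentDistrib.refl aemeasurable_const
  have hmeas {W : ι → T → Ω → E} (hW : ∀ i, StronglyMeasurable (Function.uncurry (W i))) :
      AEMeasurable (fun ω i => ∫ s, W i s ω ∂μ) P :=
    (measurable_pi_lambda _ fun i => (hW i).integral_prod_left.measurable).aemeasurable
  rw [identDistrib_iff_forall_finset_identDistrib (hmeas hUm) (hmeas hVm)]
  intro I
  have htendsto {W : ι → T → Ω → E} (hW : ∀ i, StronglyMeasurable (Function.uncurry (W i)))
      (hWi : ∀ i, ∀ᵐ ω ∂P, Integrable (fun s => W i s ω) μ) :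
      ∀ᵐ S ∂samplingLaw μ, ∀ᵐ ω ∂P, Tendsto (fun n (i : I) => monteCarlo μ S n fun s => W i s ω)
        atTop (𝓝 fun i => ∫ s, W i s ω ∂μ) := by
    filter_upwards [ae_all_iff.2 fun i : I => ae_ae_tendsto_monteCarlo (hW i) (hWi i)] with S hS
    filter_upwards [ae_all_iff.2 hS] with ω hω using tendsto_pi_nhds.2 hω
  obtain ⟨S, hSU, hSV⟩ := ((htendsto hUm hU).and (htendsto hVm hV)).exists
  exact identDistrib_of_ae_tendsto (fun n => identDistrib_monteCarlo (h.comp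
    (u := fun x (p : I × T) => x (p.1, p.2)) (by fun_prop)) S n) hSU hSV

end IdentDistrib

section Gaussian

variable {T Ω E : Type*} [MeasurableSpace T] [MeasurableSpace Ω] {P : Measure Ω}
  {μ : Measure T} [SigmaFinite μ]

lemma integral_sq_eq_toReal_eLpNorm_sq {A : Ω → ℝ} (hA : AEStronglyMeasurable A P) :
    ∫ ω, A ω ^ 2 ∂P = (eLpNorm A 2 P).toReal ^ 2 := by
  rw [← ENNReal.toReal_pow, eLpNorm_two_sq,
    integral_eq_lintegral_of_nonneg_ae (.of_forall fun ω => sq_nonneg (A ω)) (hA.pow 2)]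
  simp_rw [← sq_abs (A _), ENNReal.ofReal_pow (abs_nonneg _), Real.enorm_eq_ofReal_abs]

lemma hasGaussianLaw_of_ae_tendsto {A : ℕ → Ω → ℝ} {B : Ω → ℝ} {C : ℝ≥0}
    (hA : ∀ n, HasGaussianLaw (A n) P) (hC : ∀ n, eLpNorm (A n) 2 P ≤ C)
    (hB : ∀ᵐ ω ∂P, Tendsto (fun n => A n ω) atTop (𝓝 (B ω))) : HasGaussianLaw B P := by
  have := (hA 0).isProbabilityMeasure
  have hBm := aemeasurable_of_tendsto_metrizable_ae _ (fun n => (hA n).aemeasurable) hB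
  have hmean (n : ℕ) : P[A n] ∈ Icc (-(C : ℝ)) C := by
    rw [mem_Icc, ← abs_le, ← Real.norm_eq_abs, ← toReal_enorm]
    refine ENNReal.toReal_le_of_le_ofReal C.2 ?_
    calc ‖P[A n]‖ₑ ≤ eLpNorm (A n) 1 P := by
          simpa only [eLpNorm_one_eq_lintegral_enorm] using enorm_integral_le_lintegral_enorm _
      _ ≤ eLpNorm (A n) 2 P := eLpNorm_le_eLpNorm_of_exponent_le one_le_two
          (hA n).aemeasurable.aestronglyMeasurable
      _ ≤ ENNReal.ofReal C := by simpa using hC n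
  have hvar (n : ℕ) : Var[A n; P] ∈ Icc 0 ((C : ℝ) ^ 2) :=
    ⟨variance_nonneg _ _, (variance_le_expectation_sq
      (hA n).aemeasurable.aestronglyMeasurable).trans <| (integral_sq_eq_toReal_eLpNorm_sq
      (hA n).aemeasurable.aestronglyMeasurable).trans_le <| by
        gcongr; exact ENNReal.toReal_le_coe_of_le_coe (hC n)⟩
  obtain ⟨⟨m, v⟩, hmv, φ, hφ, hlim⟩ := (isCompact_Icc.prod isCompact_Icc).tendsto_subseq
    fun n => mk_mem_prod (hmean n) (hvar n)
  have hlim_mean : Tendsto (fun n => P[A (φ n)]) atTop (𝓝 m) := hlim.fst_nhds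
  have hlim_var : Tendsto (fun n => Var[A (φ n); P]) atTop (𝓝 v) := hlim.snd_nhds
  have hdistrib := tendstoInDistribution_of_ae_tendsto
    (fun n => (hA (φ n)).aemeasurable) hBm (hB.mono fun ω hω => hω.comp hφ.tendsto_atTop)
  have hlaw : P.map B = gaussianReal m v.toNNReal := by
    have := Measure.isProbabilityMeasure_map (μ := P) hBm
    refine Measure.ext_of_charFun (funext fun t => tendsto_nhds_unique
      (ProbabilityMeasure.tendsto_iff_tendsto_charFun.1 hdistrib.tendsto t) ?_)
    simp only [ProbabilityMeasure.coe_mk, (hA _).map_eq_gaussianReal, charFun_gaussianReal,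
      Real.coe_toNNReal _ (hvar _).1, Real.coe_toNNReal v hmv.2.1]
    exact (Complex.continuous_exp.tendsto _).comp <|
      (((Complex.continuous_ofReal.tendsto _).comp hlim_mean).const_mul _ |>.mul_const _).sub
        (((Complex.continuous_ofReal.tendsto _).comp hlim_var).mul_const _ |>.div_const _)
  exact ⟨hlaw ▸ inferInstance⟩

lemma eLpNorm_monteCarlo_le [NormedAddCommGroup E] [NormedSpace ℝ E] {X : T → Ω → E}
    (hX : ∀ s, MemLp (X s) 2 P) (S : ℕ → T) (n : ℕ) :
    eLpNorm (fun ω => monteCarlo μ S n fun s => X s ω) 2 P ≤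
      ENNReal.ofReal (monteCarlo μ S n fun s => (eLpNorm (X s) 2 P).toReal) := by
  unfold monteCarlo
  simp only [smul_eq_mul]
  rw [ENNReal.ofReal_mul (by positivity), ENNReal.ofReal_sum_of_nonneg fun i _ => by positivity]
  have hsum := eLpNorm_sum_le (μ := P) (p := 2) (s := Finset.range n)
    (f := fun i => (μ.rnDeriv μ.toFinite (S i)).toReal • X (S i))
    (fun i _ => ((hX _).const_smul _).aestronglyMeasurable) one_le_two
  calc eLpNorm (fun ω => (n : ℝ)⁻¹ •
        ∑ i ∈ Finset.range n, (μ.rnDeriv μ.toFinite (S i)).toReal • X (S i) ω) 2 P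
      = ‖(n : ℝ)⁻¹‖ₑ * eLpNorm
        (∑ i ∈ Finset.range n, (μ.rnDeriv μ.toFinite (S i)).toReal • X (S i)) 2 P := by
        rw [← eLpNorm_const_smul]
        congr 1 with ω
        simp
    _ ≤ _ := by
        rw [Real.enorm_of_nonneg (by positivity)]
        refine mul_le_mul_right (hsum.trans_eq (Finset.sum_congr rfl fun i _ => ?_)) _
        rw [eLpNorm_const_smul, Real.enorm_of_nonneg (by positivity),
          ENNReal.ofReal_mul (by positivity), ENNReal.ofReal_toReal (hX _).eLpNorm_ne_top]

lemma IsL2Integrable.hasGaussianLaw_integral_real {X : T → Ω → ℝ} (hX : IsL2Integrable X μ P)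
    (hG : IsGaussianProcess X P) : HasGaussianLaw (fun ω => ∫ s, X s ω ∂μ) P := by
  have := hG.isProbabilityMeasure
  rcases eq_zero_or_neZero μ with rfl | _
  · simp only [integral_zero_measure]
    exact ⟨by rw [Measure.map_const, measure_univ, one_smul]; infer_instance⟩
  have hnorm : Measurable fun s => eLpNorm (X s) 2 P := measurable_eLpNorm_two hX.stronglyMeasurable
  have hint : Integrable (fun s => (eLpNorm (X s) 2 P).toReal) μ :=
    integrable_toReal_of_lintegral_ne_top hnorm.aemeasurable hX.lintegral_eLpNorm_lt_top.ne
  obtain ⟨S, hS, hSnorm⟩ := ((ae_ae_tendsto_monteCarlo hX.stronglyMeasurable hX.ae_integrable).and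
    (ae_tendsto_monteCarlo hnorm.ennreal_toReal.stronglyMeasurable hint)).exists
  obtain ⟨C, hC⟩ := hSnorm.bddAbove_range
  have hgauss (n : ℕ) : HasGaussianLaw (fun ω => monteCarlo μ S n fun s => X s ω) P :=
    ((hG.comp_right S).smul fun i => (μ.rnDeriv μ.toFinite (S i)).toReal)
      |>.hasGaussianLaw_fun_sum.fun_smul _
  exact hasGaussianLaw_of_ae_tendsto (C := C.toNNReal) hgauss (fun n =>
    (eLpNorm_monteCarlo_le (fun s => (hG.hasGaussianLaw_eval s).memLp_two) S n).trans
      (ENNReal.ofReal_le_ofReal (hC (mem_range_self n)))) hS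

lemma IsL2Integrable.hasGaussianLaw_integral [NormedAddCommGroup E] [NormedSpace ℝ E]
    [CompleteSpace E] [MeasurableSpace E] [BorelSpace E] [SecondCountableTopology E]
    {X : T → Ω → E} (hX : IsL2Integrable X μ P) (hG : IsGaussianProcess X P) :
    HasGaussianLaw (fun ω => ∫ s, X s ω ∂μ) P := by
  have := hG.isProbabilityMeasure
  have hm := hX.stronglyMeasurable_integral.measurable.aemeasurable (μ := P)
  refine ⟨isGaussian_of_map_eq_gaussianReal fun L => ?_⟩
  have hL : (fun ω => L (∫ s, X s ω ∂μ)) =ᵐ[P] fun ω => ∫ s, L (X s ω) ∂μ := by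
    filter_upwards [hX.ae_integrable] with ω hω using (L.integral_comp_comm hω).symm
  have hLgauss : HasGaussianLaw (fun ω => L (∫ s, X s ω ∂μ)) P :=
    ((hX.clm_comp L).hasGaussianLaw_integral_real (hG.comp_left fun _ => L)).congr hL.symm
  rw [AEMeasurable.map_map_of_aemeasurable (by fun_prop) hm]
  exact ⟨_, _, hLgauss.map_eq_gaussianReal⟩

end Gaussian

section SeminormGrowth

lemma map_nsmul_le {G F : Type*} [AddGroup G] [FunLike F G ℝ] [AddGroupSeminormClass F G ℝ] (p : F)
    (n : ℕ) (x : G) : p (n • x) ≤ n * p x := by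
  induction n with
  | zero => simp [map_zero p]
  | succ n ih =>
    calc p ((n + 1) • x) ≤ p (n • x) + p x := succ_nsmul x n ▸ map_add_le_add p _ _
      _ ≤ n * p x + p x := by gcongr
      _ = (n + 1 : ℕ) * p x := by push_cast; ring

lemma exists_eventually_seminorm_le {G : Type*} [AddGroup G] [TopologicalSpace G]
    [IsTopologicalAddGroup G] [LocallyCompactSpace G] [SecondCountableTopology G]
    [MeasurableSpace G] [BorelSpace G]
    {p : AddGroupSeminorm G} (hp : Measurable p) : ∃ C : ℝ, ∀ᶠ x in 𝓝 0, p x ≤ C := by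
  have hcover : (⋃ n : ℕ, {x | p x ≤ n}) = univ := iUnion_eq_univ_iff.2 fun x => exists_nat_ge (p x)
  obtain ⟨n, hn⟩ := exists_measure_pos_of_not_measure_iUnion_null (μ := Measure.addHaar)
    (by rw [hcover]; exact NeZero.ne _)
  refine ⟨n + n, mem_of_superset (Measure.sub_mem_nhds_zero_of_addHaar_pos Measure.addHaar _
    (measurableSet_le hp measurable_const) hn) ?_⟩
  rintro _ ⟨x, hx, y, hy, rfl⟩
  exact (map_sub_le_add p x y).trans (add_le_add hx hy)

lemma exists_seminorm_le_mul_one_add_norm {E : Type*} [NormedAddCommGroup E] [NormedSpace ℝ E]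
    {p : AddGroupSeminorm E} {C : ℝ} (hC : ∀ᶠ x in 𝓝 0, p x ≤ C) :
    ∃ c : ℝ≥0, ∀ x, p x ≤ c * (1 + ‖x‖) := by
  obtain ⟨δ, hδ, hball⟩ := Metric.eventually_nhds_iff.1 hC
  have hC₀ : 0 ≤ C := (apply_nonneg p 0).trans hC.self_of_nhds
  refine ⟨⟨C * (1 + δ⁻¹), by positivity⟩, fun x => ?_⟩
  set n := ⌊‖x‖ / δ⌋₊ + 1
  have hn : (0 : ℝ) < n := by positivity
  have hsmall : p ((n : ℝ)⁻¹ • x) ≤ C := hball <| by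
    rw [dist_zero_right, norm_smul, norm_inv, Real.norm_natCast, inv_mul_lt_iff₀ hn,
      ← div_lt_iff₀ hδ]
    exact_mod_cast Nat.lt_floor_add_one (‖x‖ / δ)
  calc p x = p (n • (n : ℝ)⁻¹ • x) := by
        rw [← Nat.cast_smul_eq_nsmul ℝ, smul_inv_smul₀ hn.ne']
    _ ≤ n * C := (map_nsmul_le p n _).trans (by gcongr)
    _ ≤ (‖x‖ / δ + 1) * C := by
        gcongr
        simpa [n] using Nat.floor_le (by positivity : 0 ≤ ‖x‖ / δ)
    _ ≤ C * (1 + δ⁻¹) * (1 + ‖x‖) := by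
        rw [div_eq_mul_inv]
        nlinarith [mul_nonneg hC₀ (norm_nonneg x), mul_nonneg hC₀ (inv_pos.2 hδ).le]

end SeminormGrowth

section Filters

variable {E F : Type*} [NormedAddCommGroup E] [NormedAddCommGroup F]

/-- A function with a finite first absolute moment `∫ (1 + |s|) ‖f s‖ ds`. This is the decay that
allows `f` to be convolved with a process of linear growth. -/
structure HasFirstMoment (f : ℝ → E) : Prop where
  stronglyMeasurable : StronglyMeasurable f
  lintegral_lt_top : ∫⁻ s, (1 + ‖s‖ₑ) * ‖f s‖ₑ < ∞

lemma lintegral_one_add_enorm_mul_comp_sub_left_le {f : ℝ → E} (hf : StronglyMeasurable f)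
    (t : ℝ) :
    ∫⁻ s, (1 + ‖s‖ₑ) * ‖f (t - s)‖ₑ ≤ (1 + ‖t‖ₑ) * ∫⁻ s, (1 + ‖s‖ₑ) * ‖f s‖ₑ := by
  have := hf.enorm
  rw [← lintegral_sub_left_eq_self _ t, ← lintegral_const_mul _ (by fun_prop)]
  refine lintegral_mono fun s => ?_
  calc (1 + ‖t - s‖ₑ) * ‖f (t - (t - s))‖ₑ
      ≤ (1 + (‖t‖ₑ + ‖s‖ₑ)) * ‖f s‖ₑ := by
        rw [sub_sub_cancel]
        gcongr
        exact enorm_sub_le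
    _ ≤ (1 + (‖t‖ₑ + ‖s‖ₑ) + ‖t‖ₑ * ‖s‖ₑ) * ‖f s‖ₑ := by gcongr ?_ * _; exact le_self_add
    _ = (1 + ‖t‖ₑ) * ((1 + ‖s‖ₑ) * ‖f s‖ₑ) := by ring

namespace HasFirstMoment

variable {f : ℝ → E} {g : ℝ → F}

lemma integrable (hf : HasFirstMoment f) : Integrable f :=
  ⟨hf.stronglyMeasurable.aestronglyMeasurable,
    (lintegral_mono fun _ => le_mul_of_one_le_left zero_le le_self_add).trans_lt
      hf.lintegral_lt_top⟩

lemma iff_integrable (hf : StronglyMeasurable f) :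
    HasFirstMoment f ↔ Integrable fun s => (1 + |s|) * ‖f s‖ := by
  have := hf.norm
  have h : ∫⁻ s, (1 + ‖s‖ₑ) * ‖f s‖ₑ = ∫⁻ s, ‖(1 + |s|) * ‖f s‖‖ₑ := by
    refine lintegral_congr fun s => ?_
    rw [enorm_mul, enorm_norm, Real.enorm_of_nonneg (by positivity : 0 ≤ 1 + |s|),
      ENNReal.ofReal_add zero_le_one (abs_nonneg s), ENNReal.ofReal_one, Real.enorm_eq_ofReal_abs s]
  exact ⟨fun hfm => ⟨by fun_prop, h.symm.trans_lt hfm.lintegral_lt_top⟩,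
    fun hint => ⟨hf, h.trans_lt hint.hasFiniteIntegral⟩⟩

lemma comp_sub_left (hf : HasFirstMoment f) (t : ℝ) : HasFirstMoment fun s => f (t - s) :=
  ⟨hf.stronglyMeasurable.comp_measurable (by fun_prop),
    (lintegral_one_add_enorm_mul_comp_sub_left_le hf.stronglyMeasurable t).trans_lt
      (ENNReal.mul_lt_top (by simp) hf.lintegral_lt_top)⟩

lemma of_enorm_le (hf : HasFirstMoment f) (hg : StronglyMeasurable g)
    (h : ∀ s, ‖g s‖ₑ ≤ ‖f s‖ₑ) : HasFirstMoment g :=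
  ⟨hg, (lintegral_mono fun s => by gcongr; exact h s).trans_lt hf.lintegral_lt_top⟩

lemma prodMk (hf : HasFirstMoment f) (hg : HasFirstMoment g) :
    HasFirstMoment fun s => (f s, g s) := by
  refine ⟨hf.stronglyMeasurable.prodMk hg.stronglyMeasurable, ?_⟩
  have := hf.stronglyMeasurable.enorm
  calc ∫⁻ s, (1 + ‖s‖ₑ) * ‖(f s, g s)‖ₑ
      ≤ ∫⁻ s, (1 + ‖s‖ₑ) * ‖f s‖ₑ + (1 + ‖s‖ₑ) * ‖g s‖ₑ := by
        refine lintegral_mono fun s => ?_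
        rw [← mul_add]
        gcongr
        simp only [enorm_eq_nnnorm, Prod.nnnorm_mk]
        exact_mod_cast max_le_add_of_nonneg zero_le zero_le
    _ = (∫⁻ s, (1 + ‖s‖ₑ) * ‖f s‖ₑ) + ∫⁻ s, (1 + ‖s‖ₑ) * ‖g s‖ₑ :=
        lintegral_add_left (by fun_prop) _
    _ < ∞ := ENNReal.add_lt_top.2 ⟨hf.lintegral_lt_top, hg.lintegral_lt_top⟩

lemma star {f : ℝ → ℂ} (hf : HasFirstMoment f) : HasFirstMoment fun s => conj (f s) :=
  hf.of_enorm_le (Complex.continuous_conj.comp_stronglyMeasurable hf.stronglyMeasurable)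
    fun s => by simp [enorm_eq_nnnorm]

end HasFirstMoment

lemma integral_comp_sub_left_eq_zero [NormedSpace ℝ E] {f : ℝ → E} (hf : ∫ s, f s = 0) (t : ℝ) :
    ∫ s, f (t - s) = 0 := by
  rw [integral_sub_left_eq_self f volume t, hf]

section Convolution

variable [NormedSpace ℝ E] {f : ℝ → E}

/-- Convolution with a mean-zero filter does not see constants, even where the convolution integral
diverges. -/
lemma convolution_sub_const (hf : Integrable f) (hf0 : ∫ s, f s = 0) (x : ℝ → ℝ) (c : ℝ) :
    (fun s => x s - c) ⋆ f = x ⋆ f := by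
  ext t
  have hc : Integrable fun s => -(c • f (t - s)) := ((hf.comp_sub_left t).smul c).neg
  have hsplit : (fun s => (x s - c) • f (t - s)) =
      fun s => x s • f (t - s) + -(c • f (t - s)) := by
    ext s; rw [sub_smul, sub_eq_add_neg]
  change ∫ s, (x s - c) • f (t - s) = ∫ s, x s • f (t - s)
  rw [hsplit]
  by_cases hx : Integrable fun s => x s • f (t - s)
  · rw [integral_add hx hc, integral_neg, integral_smul, integral_comp_sub_left_eq_zero hf0,
      smul_zero, neg_zero, add_zero]
  · rw [integral_undef hx, integral_undef (mt (integrable_add_iff_integrable_left' hc).1 hx)]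

lemma convolution_shift (x : ℝ → ℝ) (h t : ℝ) :
    ((fun s => x (s + h)) ⋆ f) t = (x ⋆ f) (t + h) := by
  change ∫ s, x (s + h) • f (t - s) = ∫ s, x s • f (t + h - s)
  rw [← integral_add_right_eq_self (fun s => x s • f (t + h - s)) h]
  simp only [add_sub_add_right_eq_sub]

end Convolution

section LinearGrowth

variable {Ω : Type*} [MeasurableSpace Ω] {P : Measure Ω} {U : ℝ → Ω → ℝ}

/-- A jointly measurable process whose `L²` norms grow at most linearly in time. Such processes can
be convolved with every filter that has a first moment. -/
structure LinearGrowth (U : ℝ → Ω → ℝ) (P : Measure Ω) : Prop where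
  measurable : Measurable (Function.uncurry U)
  exists_eLpNorm_le : ∃ c : ℝ≥0, ∀ s, eLpNorm (U s) 2 P ≤ c * (1 + ‖s‖ₑ)

variable [NormedSpace ℝ E] {f : ℝ → E}

/-- The process `|U ⋆ f|`, the modulus nonlinearity of the scattering transform applied to a
filtered process. -/
noncomputable def filterModulus (f : ℝ → E) (U : ℝ → Ω → ℝ) (t : ℝ) (ω : Ω) : ℝ :=
  ‖((fun s => U s ω) ⋆ f) t‖

namespace LinearGrowth

lemma lintegral_eLpNorm_smul_le {c : ℝ≥0} (hc : ∀ s, eLpNorm (U s) 2 P ≤ c * (1 + ‖s‖ₑ)) :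
    ∫⁻ s, eLpNorm (fun ω => U s ω • f s) 2 P ≤ c * ∫⁻ s, (1 + ‖s‖ₑ) * ‖f s‖ₑ := by
  rw [← lintegral_const_mul' _ _ ENNReal.coe_ne_top]
  refine lintegral_mono fun s => ?_
  calc eLpNorm (fun ω => U s ω • f s) 2 P ≤ ‖f s‖ₑ * eLpNorm (U s) 2 P :=
        eLpNorm_le_nnreal_smul_eLpNorm_of_ae_le_mul (c := ‖f s‖₊)
          (.of_forall fun ω => by rw [nnnorm_smul, mul_comm]) 2
    _ ≤ ‖f s‖ₑ * (c * (1 + ‖s‖ₑ)) := by gcongr; exact hc s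
    _ = c * ((1 + ‖s‖ₑ) * ‖f s‖ₑ) := by ring

lemma isL2Integrable_smul (hU : LinearGrowth U P) (hf : HasFirstMoment f) :
    IsL2Integrable (fun s ω => U s ω • f s) volume P := by
  obtain ⟨c, hc⟩ := hU.exists_eLpNorm_le
  exact ⟨hU.measurable.stronglyMeasurable.smul
      (hf.stronglyMeasurable.comp_measurable measurable_fst),
    (lintegral_eLpNorm_smul_le hc).trans_lt
      (ENNReal.mul_lt_top ENNReal.coe_lt_top hf.lintegral_lt_top)⟩

lemma ae_convolutionExistsAt (hU : LinearGrowth U P) (hf : HasFirstMoment f) [SFinite P] (t : ℝ) :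
    ∀ᵐ ω ∂P, ConvolutionExistsAt (fun s => U s ω) f t (ContinuousLinearMap.lsmul ℝ ℝ) volume :=
  (hU.isL2Integrable_smul (hf.comp_sub_left t)).ae_integrable

lemma memLp_convolution (hU : LinearGrowth U P) (hf : HasFirstMoment f) [SFinite P] (t : ℝ) :
    MemLp (fun ω => ((fun s => U s ω) ⋆ f) t) 2 P :=
  (hU.isL2Integrable_smul (hf.comp_sub_left t)).memLp_integral

protected lemma filterModulus (hU : LinearGrowth U P) (hf : HasFirstMoment f) [SFinite P] :
    LinearGrowth (filterModulus f U) P := by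
  obtain ⟨c, hc⟩ := hU.exists_eLpNorm_le
  refine ⟨?_, c * (∫⁻ s, (1 + ‖s‖ₑ) * ‖f s‖ₑ).toNNReal, fun t => ?_⟩
  · have hmeas : StronglyMeasurable fun p : (ℝ × Ω) × ℝ => U p.2 p.1.2 • f (p.1.1 - p.2) :=
      (hU.measurable.comp (by fun_prop : Measurable fun p : (ℝ × Ω) × ℝ =>
        (p.2, p.1.2))).stronglyMeasurable.smul
      (hf.stronglyMeasurable.comp_measurable (by fun_prop))
    exact hmeas.integral_prod_right.norm.measurable
  · calc eLpNorm (Scattering.filterModulus f U t) 2 P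
        = eLpNorm (fun ω => ∫ s, U s ω • f (t - s)) 2 P := eLpNorm_norm _
      _ ≤ ∫⁻ s, eLpNorm (fun ω => U s ω • f (t - s)) 2 P :=
          (hU.isL2Integrable_smul (hf.comp_sub_left t)).eLpNorm_integral_le
      _ ≤ c * ((1 + ‖t‖ₑ) * ∫⁻ s, (1 + ‖s‖ₑ) * ‖f s‖ₑ) :=
          (lintegral_eLpNorm_smul_le hc).trans <| by
            gcongr
            exact lintegral_one_add_enorm_mul_comp_sub_left_le hf.stronglyMeasurable t
      _ = _ := by
          rw [ENNReal.coe_mul, ENNReal.coe_toNNReal hf.lintegral_lt_top.ne]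
          ring

end LinearGrowth

end LinearGrowth

end Filters

section StationaryIncrements

variable {Ω : Type*} [MeasurableSpace Ω] {P : Measure Ω}

/-- A jointly measurable, square integrable process whose increments `Z t - Z s` are distributed
like `Z (t - s)`. In particular `Z 0 = 0` almost surely; the standard example is
`Z t = X t - X 0` for a process `X` with stationary increments. -/
structure IsStationaryIncrementProcess (Z : ℝ → Ω → ℝ) (P : Measure Ω) : Prop where
  measurable : Measurable (Function.uncurry Z)
  memLp : ∀ t, MemLp (Z t) 2 P
  identDistrib_sub : ∀ s t, IdentDistrib (fun ω => Z t ω - Z s ω) (Z (t - s)) P P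

lemma measurable_uncurry_sub_zero {X : ℝ → Ω → ℝ} (hX : Measurable (Function.uncurry X)) :
    Measurable (Function.uncurry fun t ω => X t ω - X 0 ω) :=
  hX.sub (hX.comp (by fun_prop : Measurable fun p : ℝ × Ω => ((0 : ℝ), p.2)))

lemma HasStationaryIncrements.isStationaryIncrementProcess {X : ℝ → Ω → ℝ}
    (hXs : HasStationaryIncrements X P) (hX : Measurable (Function.uncurry X))
    (hX2 : ∀ s t, MemLp (fun ω => X t ω - X s ω) 2 P) :
    IsStationaryIncrementProcess (fun t ω => X t ω - X 0 ω) P where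
  measurable := measurable_uncurry_sub_zero hX
  memLp := hX2 0
  identDistrib_sub s t := by
    simpa [Function.comp_def] using (hXs s).comp (measurable_pi_apply (t - s))

namespace IsStationaryIncrementProcess

variable {Z : ℝ → Ω → ℝ}

lemma mean [IsProbabilityMeasure P] (hZ : IsStationaryIncrementProcess Z P) :
    IsStationaryIncrementProcess (fun t (_ : Ω) => ∫ ω, Z t ω ∂P) P where
  measurable := (hZ.measurable.stronglyMeasurable.integral_prod_right (ν := P)).measurable.comp
    measurable_fst
  memLp _ := memLp_const _
  identDistrib_sub s t := by
    rw [← integral_sub ((hZ.memLp t).integrable one_le_two) ((hZ.memLp s).integrable one_le_two),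
      (hZ.identDistrib_sub s t).integral_eq]
    exact .refl aemeasurable_const

/-- The seminorm `t ↦ ‖Z t‖_{L²}`, whose square is the variogram of the process. -/
noncomputable def l2Seminorm (hZ : IsStationaryIncrementProcess Z P) : AddGroupSeminorm ℝ where
  toFun t := (eLpNorm (Z t) 2 P).toReal
  map_zero' := by
    have h := (hZ.identDistrib_sub 0 0).eLpNorm_eq (p := 2)
    simp only [sub_self, eLpNorm_zero'] at h
    rw [← h, ENNReal.toReal_zero]
  add_le' s t := by
    have h := (hZ.identDistrib_sub s (s + t)).eLpNorm_eq (p := 2)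
    rw [add_sub_cancel_left] at h
    rw [← ENNReal.toReal_add (hZ.memLp s).2.ne (hZ.memLp t).2.ne]
    refine ENNReal.toReal_mono (ENNReal.add_ne_top.2 ⟨(hZ.memLp s).2.ne, (hZ.memLp t).2.ne⟩) ?_
    calc eLpNorm (Z (s + t)) 2 P = eLpNorm (Z s + (Z (s + t) - Z s)) 2 P := by
          rw [add_sub_cancel]
      _ ≤ eLpNorm (Z s) 2 P + eLpNorm (Z (s + t) - Z s) 2 P :=
          eLpNorm_add_le (hZ.memLp s).1 ((hZ.memLp _).1.sub (hZ.memLp s).1) one_le_two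
      _ = eLpNorm (Z s) 2 P + eLpNorm (Z t) 2 P := congrArg _ h
  neg' t := by
    have h₁ := (hZ.identDistrib_sub t 0).eLpNorm_eq (p := 2)
    have h₂ := (hZ.identDistrib_sub 0 t).eLpNorm_eq (p := 2)
    rw [zero_sub] at h₁
    rw [sub_zero] at h₂
    rw [← h₁, ← h₂]
    exact congrArg _ (eLpNorm_sub_comm (Z 0) (Z t) 2 P)

lemma measurable_l2Seminorm [SFinite P] (hZ : IsStationaryIncrementProcess Z P) :
    Measurable hZ.l2Seminorm :=
  (measurable_eLpNorm_two hZ.measurable.stronglyMeasurable).ennreal_toReal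

lemma linearGrowth [SFinite P] (hZ : IsStationaryIncrementProcess Z P) : LinearGrowth Z P := by
  obtain ⟨C, hC⟩ := exists_eventually_seminorm_le hZ.measurable_l2Seminorm
  obtain ⟨c, hc⟩ := exists_seminorm_le_mul_one_add_norm hC
  refine ⟨hZ.measurable, c, fun s => ?_⟩
  calc eLpNorm (Z s) 2 P = ENNReal.ofReal (hZ.l2Seminorm s) :=
        (ENNReal.ofReal_toReal (hZ.memLp s).2.ne).symm
    _ ≤ ENNReal.ofReal (c * (1 + ‖s‖)) := ENNReal.ofReal_le_ofReal (hc s)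
    _ = c * (1 + ‖s‖ₑ) := by
        rw [ENNReal.ofReal_mul c.coe_nonneg, ENNReal.ofReal_coe_nnreal,
          ENNReal.ofReal_add zero_le_one (norm_nonneg s), ENNReal.ofReal_one, ofReal_norm]

lemma integral_mul (hZ : IsStationaryIncrementProcess Z P) (s r : ℝ) :
    ∫ ω, Z s ω * Z r ω ∂P =
      (hZ.l2Seminorm s ^ 2 + hZ.l2Seminorm r ^ 2 - hZ.l2Seminorm (s - r) ^ 2) / 2 := by
  have hsq (t : ℝ) : hZ.l2Seminorm t ^ 2 = ∫ ω, Z t ω ^ 2 ∂P :=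
    (integral_sq_eq_toReal_eLpNorm_sq (hZ.memLp t).1).symm
  have hsub : hZ.l2Seminorm (s - r) ^ 2 = ∫ ω, (Z s ω - Z r ω) ^ 2 ∂P := by
    rw [hsq]
    exact ((hZ.identDistrib_sub r s).comp (measurable_id.pow_const 2)).integral_eq.symm
  have hadd : Integrable (fun ω => Z s ω ^ 2 + Z r ω ^ 2) P :=
    (hZ.memLp s).integrable_sq.add (hZ.memLp r).integrable_sq
  have hdiff : Integrable (fun ω => (Z s ω - Z r ω) ^ 2) P :=
    ((hZ.memLp s).sub (hZ.memLp r)).integrable_sq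
  rw [eq_div_iff two_ne_zero, ← integral_mul_const, hsq, hsq, hsub,
    ← integral_add (hZ.memLp s).integrable_sq (hZ.memLp r).integrable_sq, ← integral_sub hadd hdiff]
  exact integral_congr_ae (.of_forall fun ω => by ring)

end IsStationaryIncrementProcess

end StationaryIncrements

section Fourier

open scoped FourierTransform SchwartzMap

section Uniqueness

variable {V F : Type*} [NormedAddCommGroup V] [InnerProductSpace ℝ V] [FiniteDimensional ℝ V]
  [MeasurableSpace V] [BorelSpace V] [NormedAddCommGroup F] [NormedSpace ℂ F] [CompleteSpace F]
  {f g : V → F}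

lemma integral_fourier_schwartz_smul_eq (k : 𝓢(V, ℂ)) (hf : Integrable f) :
    ∫ x, 𝓕 (k : V → ℂ) x • f x = ∫ x, k x • 𝓕 f x := by
  have h := VectorFourier.integral_fourierIntegral_smul_eq_flip (L := innerₗ V)
    Real.continuous_fourierChar continuous_inner (k.integrable (μ := volume)) hf
  rwa [flip_innerₗ] at h

lemma ae_eq_of_fourier_eq (hf : Integrable f) (hg : Integrable g) (h : 𝓕 f = 𝓕 g) :
    f =ᵐ[volume] g := by
  refine ae_eq_of_integral_contDiff_smul_eq hf.locallyIntegrable hg.locallyIntegrable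
    fun φ hφ hφc => ?_
  have hφc' : HasCompactSupport fun x => (φ x : ℂ) :=
    hφc.comp_left (g := Complex.ofReal) Complex.ofReal_zero
  set k : 𝓢(V, ℂ) := 𝓕⁻ (hφc'.toSchwartzMap (Complex.ofRealCLM.contDiff.comp hφ))
  have hk (u : V → F) (hu : Integrable u) : ∫ x, φ x • u x = ∫ x, k x • 𝓕 u x := by
    rw [← integral_fourier_schwartz_smul_eq k hu, ← SchwartzMap.fourier_coe,
      FourierTransform.fourier_fourierInv_eq]
    rfl
  rw [hk f hf, hk g hg, h]

end Uniqueness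

variable {f g : ℝ → ℂ}

lemma fourier_eq_angularFourier (f : ℝ → ℂ) (ξ : ℝ) :
    𝓕 f ξ = angularFourier f (2 * Real.pi * ξ) := by
  rw [Real.fourier_real_eq_integral_exp_smul, angularFourier]
  refine integral_congr_ae (.of_forall fun t => ?_)
  simp only [smul_eq_mul]
  rw [mul_comm]
  congr 2
  push_cast
  ring

lemma angularFourier_comp_neg (f : ℝ → ℂ) (ω : ℝ) :
    angularFourier (fun t => f (-t)) ω = angularFourier f (-ω) := by
  rw [angularFourier, angularFourier, ← integral_neg_eq_self]
  simp

lemma angularFourier_conj (f : ℝ → ℂ) (ω : ℝ) :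
    angularFourier (fun t => conj (f t)) ω = conj (angularFourier f (-ω)) := by
  rw [angularFourier, angularFourier, ← integral_conj]
  simp [← Complex.exp_conj]

lemma ae_comp_neg_eq_conj (hf : Integrable f) (hreal : ∀ ω, (angularFourier f ω).im = 0) :
    ∀ᵐ t, f (-t) = conj (f t) := by
  refine ae_eq_of_fourier_eq hf.comp_neg (Complex.conjCLE.integrable_comp_iff.2 hf) ?_
  ext ξ
  rw [fourier_eq_angularFourier, fourier_eq_angularFourier, angularFourier_comp_neg,
    angularFourier_conj, Complex.conj_eq_iff_im.2 (hreal _)]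

/-- The Fourier transform of the correlation `w ↦ ∫ f(w + r) g(r) dr` is `f̂(ω) ĝ(-ω)`. -/
lemma ae_correlation_eq_zero (hf : Integrable f) (hg : Integrable g)
    (hfg : ∀ ω, angularFourier f ω * angularFourier g (-ω) = 0) :
    ∀ᵐ w, ∫ r, f (w + r) * g r = 0 := by
  have hconv : ((fun t => g (-t)) ⋆[ContinuousLinearMap.mul ℂ ℂ] f) =ᵐ[volume] 0 := by
    refine ae_eq_of_fourier_eq (hg.comp_neg.integrable_convolution _ hf) (integrable_zero _ _ _) ?_
    ext ξ
    rw [Real.fourier_mul_convolution_eq hg.comp_neg hf, fourier_eq_angularFourier,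
      fourier_eq_angularFourier, fourier_eq_angularFourier, angularFourier_comp_neg, mul_comm, hfg]
    simp [angularFourier]
  filter_upwards [hconv] with w hw
  rw [← integral_neg_eq_self]
  simpa [convolution, mul_comm, sub_eq_add_neg] using hw

end Fourier

section VariogramKernel

section Seminorm

variable {G : Type*} [AddCommGroup G]

lemma abs_sq_add_sq_sub_sq_le (p : AddGroupSeminorm G) (x y : G) :
    |p x ^ 2 + p y ^ 2 - p (x - y) ^ 2| ≤ 2 * (p x * p y) := by
  have hupper : p (x - y) ≤ p x + p y := map_sub_le_add p x y
  have hlower : |p x - p y| ≤ p (x - y) := abs_sub_map_le_sub p x y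
  have hsq := sq_le_sq' (by linarith [abs_nonneg (p x - p y), apply_nonneg p (x - y)]) hupper
  have hsq' := (sq_abs (p x - p y)).symm.trans_le (pow_le_pow_left₀ (abs_nonneg _) hlower 2)
  exact abs_le.2 ⟨by linarith, by linarith⟩

/-- The bounded seminorm `x ↦ min (p x) C`. -/
def truncatedSeminorm (p : AddGroupSeminorm G) (C : ℝ≥0) : AddGroupSeminorm G where
  toFun x := min (p x) C
  map_zero' := by simp
  add_le' x y := by
    rcases le_total (p x) C with hx | hx <;> rcases le_total (p y) C with hy | hy <;>
      simp only [hx, hy, min_eq_left, min_eq_right]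
    · exact min_le_of_left_le (map_add_le_add p x y)
    · exact min_le_of_right_le (le_add_of_nonneg_left (apply_nonneg p x))
    · exact min_le_of_right_le (le_add_of_nonneg_right (apply_nonneg p y))
    · exact min_le_of_right_le (le_add_of_nonneg_right C.coe_nonneg)
  neg' x := by rw [map_neg_eq_map]

lemma tendsto_truncatedSeminorm (p : AddGroupSeminorm G) (x : G) :
    Tendsto (fun n : ℕ => truncatedSeminorm p n x) atTop (𝓝 (p x)) := by
  obtain ⟨N, hN⟩ := exists_nat_ge (p x)
  refine tendsto_atTop_of_eventually_const (i₀ := N) fun n hn => min_eq_left ?_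
  exact hN.trans (by exact_mod_cast hn)

end Seminorm

/-- The kernel `p(s)² + p(r)² - p(s - r)²`, which is twice the covariance kernel of a process with
stationary increments and variogram `p²`. -/
def variogramKernel (p : AddGroupSeminorm ℝ) (z : ℝ × ℝ) : ℝ :=
  p z.1 ^ 2 + p z.2 ^ 2 - p (z.1 - z.2) ^ 2

variable {f g : ℝ → ℂ}

lemma integral_increment_kernel_eq_zero {γ : ℝ → ℝ} (hγ : Measurable γ) {C : ℝ}
    (hC : ∀ t, ‖γ t‖ ≤ C) (hf : Integrable f) (hg : Integrable g) (hf0 : ∫ s, f s = 0)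
    (hg0 : ∫ s, g s = 0) (hfg : ∀ᵐ w, ∫ r, f (w + r) * g r = 0) :
    ∫ z : ℝ × ℝ, (γ z.1 + γ z.2 - γ (z.1 - z.2)) • (f z.1 * g z.2) ∂volume.prod volume = 0 := by
  have hint (φ : ℝ × ℝ → ℝ) (hφ : Measurable φ) :
      Integrable (fun z => γ (φ z) • (f z.1 * g z.2)) (volume.prod volume) :=
    (hf.mul_prod hg).bdd_smul C (hγ.comp hφ).aestronglyMeasurable (.of_forall fun _ => hC _)
  have h₁ := hint (fun z => z.1) (by fun_prop)
  have h₂ := hint (fun z => z.2) (by fun_prop)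
  have h₃ := hint (fun z => z.1 - z.2) (by fun_prop)
  have hfst : ∫ z : ℝ × ℝ, γ z.1 • (f z.1 * g z.2) ∂volume.prod volume = 0 := by
    simp only [← smul_mul_assoc]
    rw [integral_prod_mul (fun s => γ s • f s) g, hg0, mul_zero]
  have hsnd : ∫ z : ℝ × ℝ, γ z.2 • (f z.1 * g z.2) ∂volume.prod volume = 0 := by
    simp only [← mul_smul_comm]
    rw [integral_prod_mul f (fun r => γ r • g r), hf0, zero_mul]
  have hsub : ∫ z : ℝ × ℝ, γ (z.1 - z.2) • (f z.1 * g z.2) ∂volume.prod volume = 0 := by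
    have hshear := measurePreserving_add_prod (volume : Measure ℝ) (volume : Measure ℝ)
    rw [← hshear.map_eq, integral_map hshear.aemeasurable (hshear.map_eq.symm ▸ h₃.1)]
    refine (integral_prod _ (hshear.integrable_comp_of_integrable h₃)).trans ?_
    refine integral_eq_zero_of_ae (hfg.mono fun w hw => ?_)
    simp only [Function.comp_apply, add_sub_cancel_right, Pi.zero_apply]
    rw [integral_smul, hw, smul_zero]
  simp only [sub_smul, add_smul]
  rw [integral_sub (by exact h₁.add h₂) h₃, integral_add h₁ h₂, hfst, hsnd, hsub, add_zero,
    sub_zero]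

lemma norm_variogramKernel_smul_le {p : AddGroupSeminorm ℝ} {c : ℝ}
    (hp : ∀ t, p t ≤ c * (1 + |t|)) (z : ℝ × ℝ) (f g : ℝ → ℂ) :
    ‖variogramKernel p z • (f z.1 * g z.2)‖ ≤
      2 * c ^ 2 * ((1 + |z.1|) * ‖f z.1‖ * ((1 + |z.2|) * ‖g z.2‖)) := by
  calc ‖variogramKernel p z • (f z.1 * g z.2)‖
      ≤ 2 * (c * (1 + |z.1|) * (c * (1 + |z.2|))) * (‖f z.1‖ * ‖g z.2‖) := by
        rw [norm_smul, norm_mul]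
        gcongr
        refine (abs_sq_add_sq_sub_sq_le _ _ _).trans ?_
        gcongr
        exacts [(apply_nonneg p _).trans (hp _), hp _, hp _]
    _ = _ := by ring

/-- The kernel may grow like `|s| |r|`, but its three terms separately like `|s|²` and `|r|²`,
which is not integrable against `f ⊗ g`. Truncating the seminorm `p` keeps the bound on the kernel
and makes the three terms bounded. -/
lemma integral_variogramKernel_eq_zero {p : AddGroupSeminorm ℝ} (hp : Measurable p)
    (hf : HasFirstMoment f) (hg : HasFirstMoment g) (hf0 : ∫ s, f s = 0) (hg0 : ∫ s, g s = 0)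
    (hfg : ∀ᵐ w, ∫ r, f (w + r) * g r = 0) :
    ∫ z : ℝ × ℝ, variogramKernel p z • (f z.1 * g z.2) ∂volume.prod volume = 0 := by
  obtain ⟨C, hC⟩ := exists_eventually_seminorm_le hp
  obtain ⟨c, hc⟩ := exists_seminorm_le_mul_one_add_norm hC
  have hpn (n : ℕ) : Measurable (truncatedSeminorm p n) := hp.min measurable_const
  have hzero (n : ℕ) : ∫ z : ℝ × ℝ, variogramKernel (truncatedSeminorm p n) z •
      (f z.1 * g z.2) ∂volume.prod volume = 0 := by
    refine integral_increment_kernel_eq_zero (γ := fun t => truncatedSeminorm p n t ^ 2)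
      ((hpn n).pow_const 2) (C := n ^ 2) (fun t => ?_) hf.integrable hg.integrable hf0 hg0 hfg
    rw [norm_pow, Real.norm_of_nonneg (apply_nonneg _ t)]
    exact pow_le_pow_left₀ (apply_nonneg _ t) (min_le_right _ _) 2
  have hbound (n : ℕ) (z : ℝ × ℝ) :
      ‖variogramKernel (truncatedSeminorm p n) z • (f z.1 * g z.2)‖ ≤
        2 * c ^ 2 * ((1 + |z.1|) * ‖f z.1‖ * ((1 + |z.2|) * ‖g z.2‖)) :=
    norm_variogramKernel_smul_le (fun t => (min_le_left _ _).trans (hc t)) z f g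
  have hlim (z : ℝ × ℝ) : Tendsto (fun n : ℕ => variogramKernel (truncatedSeminorm p n) z •
      (f z.1 * g z.2)) atTop (𝓝 (variogramKernel p z • (f z.1 * g z.2))) :=
    ((((tendsto_truncatedSeminorm p _).pow 2).add ((tendsto_truncatedSeminorm p _).pow 2)).sub
      ((tendsto_truncatedSeminorm p _).pow 2)).smul_const _
  have hconv := tendsto_integral_of_dominated_convergence _ (fun n => ?_)
    ((((HasFirstMoment.iff_integrable hf.stronglyMeasurable).1 hf).mul_prod
      ((HasFirstMoment.iff_integrable hg.stronglyMeasurable).1 hg)).const_mul _)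
    (fun n => .of_forall (hbound n)) (.of_forall hlim)
  · simp only [hzero] at hconv
    exact tendsto_nhds_unique hconv tendsto_const_nhds
  · have hk : Measurable (variogramKernel (truncatedSeminorm p n)) := by
      unfold variogramKernel
      have := hpn n
      fun_prop
    exact hk.aestronglyMeasurable.smul (hf.integrable.mul_prod hg.integrable).1

end VariogramKernel

namespace IsStationaryIncrementProcess

variable {Ω : Type*} [MeasurableSpace Ω] {P : Measure Ω} {Z : ℝ → Ω → ℝ} {f g : ℝ → ℂ}

lemma integral_mul_integral_eq_zero [SFinite P] (hZ : IsStationaryIncrementProcess Z P)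
    (hf : HasFirstMoment f) (hg : HasFirstMoment g) (hf0 : ∫ s, f s = 0) (hg0 : ∫ s, g s = 0)
    (hfg : ∀ ω, angularFourier f ω * angularFourier g (-ω) = 0) :
    ∫ ω, (∫ s, Z s ω • f s) * (∫ s, Z s ω • g s) ∂P = 0 := by
  have hcov (z : ℝ × ℝ) : ∫ ω, Z z.1 ω • f z.1 * Z z.2 ω • g z.2 ∂P =
      (2⁻¹ : ℝ) • variogramKernel hZ.l2Seminorm z • (f z.1 * g z.2) := by
    simp only [smul_mul_smul_comm]
    rw [integral_smul_const, hZ.integral_mul, smul_smul, variogramKernel, inv_mul_eq_div]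
  rw [IsL2Integrable.integral_mul_integral (hZ.linearGrowth.isL2Integrable_smul hf)
    (hZ.linearGrowth.isL2Integrable_smul hg)]
  simp only [hcov]
  rw [integral_smul, integral_variogramKernel_eq_zero hZ.measurable_l2Seminorm hf hg hf0 hg0
    (ae_correlation_eq_zero hf.integrable hg.integrable hfg), smul_zero]

end IsStationaryIncrementProcess

section GaussianIndependence

variable {Ω : Type*} [MeasurableSpace Ω] {P : Measure Ω}

lemma inner_mul_inner_eq_re (x y a b : ℂ) :
    inner ℝ x a * inner ℝ y b =
      ((conj x * conj y) * (a * b) + (conj x * y) * (a * conj b)).re / 2 := by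
  simp only [Complex.inner, Complex.mul_re, Complex.mul_im, Complex.add_re, Complex.conj_re,
    Complex.conj_im]
  ring

/-- For jointly Gaussian complex variables, independence needs both the covariance and the
pseudo-covariance to vanish. -/
lemma indepFun_of_integral_mul_eq [IsProbabilityMeasure P] {A B : Ω → ℂ}
    (hAB : HasGaussianLaw (fun ω => (A ω, B ω)) P)
    (hcov : ∫ ω, A ω * conj (B ω) ∂P = (∫ ω, A ω ∂P) * conj (∫ ω, B ω ∂P))
    (hpseudo : ∫ ω, A ω * B ω ∂P = (∫ ω, A ω ∂P) * ∫ ω, B ω ∂P) : IndepFun A B P := by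
  have hA : MemLp A 2 P := hAB.fst.memLp_two
  have hB : MemLp B 2 P := hAB.snd.memLp_two
  have hint : Integrable (fun ω => A ω * B ω) P := hA.integrable_mul hB
  have hint' : Integrable (fun ω => A ω * conj (B ω)) P := hA.integrable_mul hB.star
  refine hAB.indepFun_of_covariance_inner fun x y => ?_
  rw [covariance_eq_sub (hA.const_inner x) (hB.const_inner y),
    integral_inner (hA.integrable one_le_two), integral_inner (hB.integrable one_le_two),
    inner_mul_inner_eq_re, ← hcov, ← hpseudo, sub_eq_zero]
  simp only [Pi.mul_apply, inner_mul_inner_eq_re]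
  have hsum := integral_add (hint.const_mul (conj x * conj y)) (hint'.const_mul (conj x * y))
  rw [integral_const_mul, integral_const_mul] at hsum
  rw [integral_div, ← hsum]
  exact congrArg (· / 2) (Complex.reCLM.integral_comp_comm
    ((hint.const_mul _).add (hint'.const_mul _)))

end GaussianIndependence

namespace IsStationaryIncrementProcess

variable {Ω : Type*} [MeasurableSpace Ω] {P : Measure Ω} {Z : ℝ → Ω → ℝ} {f g : ℝ → ℂ}

lemma integral_integral_mul_integral_integral_eq_zero [IsProbabilityMeasure P]
    (hZ : IsStationaryIncrementProcess Z P) (hf : HasFirstMoment f) (hg : HasFirstMoment g)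
    (hf0 : ∫ s, f s = 0) (hg0 : ∫ s, g s = 0)
    (hfg : ∀ ω, angularFourier f ω * angularFourier g (-ω) = 0) :
    (∫ ω, (∫ s, Z s ω • f s) ∂P) * ∫ ω, (∫ s, Z s ω • g s) ∂P = 0 := by
  have h := hZ.mean.integral_mul_integral_eq_zero hf hg hf0 hg0 hfg
  rw [(hZ.linearGrowth.isL2Integrable_smul hf).integral_integral,
    (hZ.linearGrowth.isL2Integrable_smul hg).integral_integral]
  simpa only [integral_smul_const, integral_const, probReal_univ, one_smul] using h

end IsStationaryIncrementProcess

lemma LinearGrowth.hasGaussianLaw_integral_smul {Ω E : Type*} [MeasurableSpace Ω] {P : Measure Ω}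
    [NormedAddCommGroup E] [NormedSpace ℝ E] [CompleteSpace E] [MeasurableSpace E] [BorelSpace E]
    [SecondCountableTopology E] {Z : ℝ → Ω → ℝ} (hZ : LinearGrowth Z P)
    (hG : IsGaussianProcess Z P) {f : ℝ → E} (hf : HasFirstMoment f) :
    HasGaussianLaw (fun ω => ∫ s, Z s ω • f s) P :=
  (hZ.isL2Integrable_smul hf).hasGaussianLaw_integral <| by
    simpa using hG.comp_left fun s => ContinuousLinearMap.toSpanSingleton ℝ (f s)

lemma IsStationaryIncrementProcess.indepFun_integral {Ω : Type*} [MeasurableSpace Ω]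
    {P : Measure Ω} {Z : ℝ → Ω → ℝ} {f g : ℝ → ℂ} (hZ : IsStationaryIncrementProcess Z P)
    (hG : IsGaussianProcess Z P) (hf : HasFirstMoment f) (hg : HasFirstMoment g)
    (hf0 : ∫ s, f s = 0) (hg0 : ∫ s, g s = 0)
    (hfg : ∀ ω, angularFourier f ω * angularFourier g ω = 0)
    (hfg' : ∀ ω, angularFourier f ω * angularFourier g (-ω) = 0) :
    IndepFun (fun ω => ∫ s, Z s ω • f s) (fun ω => ∫ s, Z s ω • g s) P := by
  have := hG.isProbabilityMeasure
  have hconj (ω) : conj (∫ s, Z s ω • g s) = ∫ s, Z s ω • conj (g s) := by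
    rw [← integral_conj]
    simp
  have hconj0 : ∫ s, conj (g s) = 0 := by rw [integral_conj, hg0, map_zero]
  have hfgc (ω) : angularFourier f ω * angularFourier (fun s => conj (g s)) (-ω) = 0 := by
    rw [angularFourier_conj, neg_neg]
    simpa using hfg ω
  refine indepFun_of_integral_mul_eq ?_ ?_ ?_
  · refine (hZ.linearGrowth.hasGaussianLaw_integral_smul hG (hf.prodMk hg)).congr ?_
    filter_upwards [(hZ.linearGrowth.isL2Integrable_smul hf).ae_integrable,
      (hZ.linearGrowth.isL2Integrable_smul hg).ae_integrable] with ω hωf hωg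
    exact integral_pair hωf hωg
  · rw [← integral_conj]
    simp only [hconj]
    rw [hZ.integral_mul_integral_eq_zero hf hg.star hf0 hconj0 hfgc,
      hZ.integral_integral_mul_integral_integral_eq_zero hf hg.star hf0 hconj0 hfgc]
  · rw [hZ.integral_mul_integral_eq_zero hf hg hf0 hg0 hfg',
      hZ.integral_integral_mul_integral_integral_eq_zero hf hg hf0 hg0 hfg']

lemma angularFourier_comp_sub_left (f : ℝ → ℂ) (t ω : ℝ) :
    angularFourier (fun s => f (t - s)) ω =
      Complex.exp (-(Complex.I * ω * t)) * angularFourier f (-ω) := by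
  rw [angularFourier, angularFourier, ← integral_const_mul, ← integral_sub_left_eq_self _ volume t]
  refine integral_congr_ae (.of_forall fun s => ?_)
  simp only [sub_sub_cancel]
  rw [mul_left_comm, ← Complex.exp_add]
  push_cast
  ring_nf

lemma IsStationaryIncrementProcess.indepFun_filterModulus {Ω : Type*} [MeasurableSpace Ω]
    {P : Measure Ω} {Z : ℝ → Ω → ℝ} {f g : ℝ → ℂ} (hZ : IsStationaryIncrementProcess Z P)
    (hG : IsGaussianProcess Z P) (hf : HasFirstMoment f) (hg : HasFirstMoment g)
    (hf0 : ∫ s, f s = 0) (hg0 : ∫ s, g s = 0)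
    (hfg : ∀ ω, angularFourier f ω * angularFourier g ω = 0)
    (hfg' : ∀ ω, angularFourier f ω * angularFourier g (-ω) = 0) (p q : ℝ) :
    IndepFun (filterModulus f Z p) (filterModulus g Z q) P := by
  refine (hZ.indepFun_integral hG (hf.comp_sub_left p) (hg.comp_sub_left q)
    (integral_comp_sub_left_eq_zero hf0 p) (integral_comp_sub_left_eq_zero hg0 q)
    (fun ω => ?_) fun ω => ?_).comp measurable_norm measurable_norm
  · simp only [angularFourier_comp_sub_left]
    rw [mul_mul_mul_comm, hfg, mul_zero]
  · simp only [angularFourier_comp_sub_left]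
    rw [mul_mul_mul_comm, hfg', mul_zero]

section SecondOrderScattering

variable {Ω ι E : Type*} [NormedAddCommGroup E] [NormedSpace ℝ E]

section Convolution

variable {f : ℝ → E}

lemma convolution_comp_sub_left (x : ℝ → ℝ) (c t : ℝ) :
    ((fun s => x (c - s)) ⋆ f) t = (x ⋆ fun s => f (-s)) (c - t) := by
  change ∫ s, x (c - s) • f (t - s) = ∫ s, x s • f (-(c - t - s))
  rw [← integral_sub_left_eq_self _ volume c]
  refine integral_congr_ae (.of_forall fun s => ?_)
  simp only [sub_sub_cancel]
  congr 2
  ring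

lemma convolution_conj (x : ℝ → ℝ) (f : ℝ → ℂ) (t : ℝ) :
    (x ⋆ fun s => conj (f s)) t = conj ((x ⋆ f) t) := by
  change ∫ s, x s • conj (f (t - s)) = conj (∫ s, x s • f (t - s))
  rw [← integral_conj]
  simp

lemma convolution_comp_sub_left_eq_conj {f : ℝ → ℂ} (hf : ∀ᵐ s, f (-s) = conj (f s))
    (x : ℝ → ℝ) (c t : ℝ) : ((fun s => x (c - s)) ⋆ f) t = conj ((x ⋆ f) (c - t)) := by
  rw [convolution_comp_sub_left, convolution_congr _ .rfl hf, convolution_conj]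

end Convolution

lemma filterModulus_sub_const {f : ℝ → E} (hf : Integrable f) (hf0 : ∫ s, f s = 0)
    (U : ℝ → Ω → ℝ) (c : Ω → ℝ) : filterModulus f (fun s ω => U s ω - c ω) = filterModulus f U := by
  ext t ω
  simp only [filterModulus, convolution_sub_const hf hf0]

lemma filterModulus_comp_add_right (f : ℝ → E) (U : ℝ → Ω → ℝ) (h t : ℝ) :
    filterModulus f (fun s => U (s + h)) t = filterModulus f U (t + h) := by
  ext ω
  exact congrArg norm (convolution_shift (fun s => U s ω) h t)

lemma filterModulus_comp_sub_left {f : ℝ → ℂ} (hf : ∀ᵐ s, f (-s) = conj (f s))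
    (U : ℝ → Ω → ℝ) (c t : ℝ) :
    filterModulus f (fun s => U (c - s)) t = filterModulus f U (c - t) := by
  ext ω
  simp only [filterModulus, convolution_comp_sub_left_eq_conj hf (fun s => U s ω), RCLike.norm_conj]

variable [MeasurableSpace Ω] {P : Measure Ω}

namespace LinearGrowth

lemma of_identDistrib {U V : ℝ → Ω → ℝ} (hU : LinearGrowth U P)
    (hV : Measurable (Function.uncurry V)) (h : ∀ s, IdentDistrib (V s) (U s) P P) :
    LinearGrowth V P := by
  obtain ⟨c, hc⟩ := hU.exists_eLpNorm_le
  exact ⟨hV, c, fun s => ((h s).eLpNorm_eq 2).trans_le (hc s)⟩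

variable [CompleteSpace E] [SecondCountableTopology E] [MeasurableSpace E] [BorelSpace E]

lemma identDistrib_convolution [IsProbabilityMeasure P] {U V : ι → ℝ → Ω → ℝ} {f : ι → ℝ → E}
    (hU : ∀ i, LinearGrowth (U i) P) (hV : ∀ i, LinearGrowth (V i) P)
    (hf : ∀ i, HasFirstMoment (f i))
    (h : IdentDistrib (fun ω (p : ι × ℝ) => U p.1 p.2 ω) (fun ω p => V p.1 p.2 ω) P P) :
    IdentDistrib (fun ω (p : ι × ℝ) => ((fun s => U p.1 s ω) ⋆ f p.1) p.2)
      (fun ω p => ((fun s => V p.1 s ω) ⋆ f p.1) p.2) P P := by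
  have hUf (p : ι × ℝ) := (hU p.1).isL2Integrable_smul ((hf p.1).comp_sub_left p.2)
  have hVf (p : ι × ℝ) := (hV p.1).isL2Integrable_smul ((hf p.1).comp_sub_left p.2)
  refine identDistrib_integral (U := fun (p : ι × ℝ) s ω => U p.1 s ω • f p.1 (p.2 - s))
    (V := fun (p : ι × ℝ) s ω => V p.1 s ω • f p.1 (p.2 - s))
    (fun p => (hUf p).stronglyMeasurable) (fun p => (hVf p).stronglyMeasurable)
    (fun p => (hUf p).ae_integrable) (fun p => (hVf p).ae_integrable) ?_
  refine h.comp (u := fun (x : ι × ℝ → ℝ) (q : (ι × ℝ) × ℝ) =>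
    x (q.1.1, q.2) • f q.1.1 (q.1.2 - q.2)) ?_
  fun_prop

lemma identDistrib_filterModulus [IsProbabilityMeasure P] {X U : ℝ → Ω → ℝ} {f : ι → ℝ → E}
    (hX : LinearGrowth (fun s ω => X s ω - X 0 ω) P) (hU : Measurable (Function.uncurry U))
    (h : IdentDistrib (fun ω s => U s ω - U 0 ω) (fun ω s => X s ω - X 0 ω) P P)
    (hf : ∀ i, HasFirstMoment (f i)) (hf0 : ∀ i, ∫ s, f i s = 0) :
    IdentDistrib (fun ω (p : ι × ℝ) => filterModulus (f p.1) U p.2 ω)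
      (fun ω p => filterModulus (f p.1) X p.2 ω) P P := by
  have hUX : LinearGrowth (fun s ω => U s ω - U 0 ω) P :=
    hX.of_identDistrib (measurable_uncurry_sub_zero hU) fun s => h.comp (measurable_pi_apply s)
  have hι := h.comp (u := fun (x : ℝ → ℝ) (p : ι × ℝ) => x p.2) (by fun_prop)
  have hnorm := (identDistrib_convolution (fun _ => hUX) (fun _ => hX) hf hι).comp
    (u := fun (x : ι × ℝ → E) p => ‖x p‖) (by fun_prop)
  have heq (Y : ℝ → Ω → ℝ) (ω : Ω) (p : ι × ℝ) :
      ‖((fun s => Y s ω - Y 0 ω) ⋆ f p.1) p.2‖ = filterModulus (f p.1) Y p.2 ω := by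
    rw [← filterModulus_sub_const (hf p.1).integrable (hf0 p.1) Y (Y 0)]
    rfl
  simpa only [Function.comp_def, heq] using hnorm

end LinearGrowth

end SecondOrderScattering

section Increments

variable {Ω ι : Type*} [MeasurableSpace Ω] {P : Measure Ω} [IsProbabilityMeasure P]
  {X : ℝ → Ω → ℝ}

namespace HasStationaryIncrements

lemma identDistrib_filterModulus_add {E : Type*} [NormedAddCommGroup E] [NormedSpace ℝ E]
    [CompleteSpace E] [SecondCountableTopology E] [MeasurableSpace E] [BorelSpace E]
    (hXs : HasStationaryIncrements X P) (hX : Measurable (Function.uncurry X))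
    (hXg : LinearGrowth (fun s ω => X s ω - X 0 ω) P) {f : ℝ → E} (hf : HasFirstMoment f)
    (hf0 : ∫ s, f s = 0) (h t : ℝ) :
    IdentDistrib (filterModulus f X (t + h)) (filterModulus f X t) P P := by
  have hid := hXg.identDistrib_filterModulus (U := fun s => X (s + h))
    (hX.comp (by fun_prop : Measurable fun p : ℝ × Ω => (p.1 + h, p.2)))
    (by simpa only [zero_add] using hXs h) (fun _ : Unit => hf) fun _ => hf0
  simpa only [Function.comp_def, filterModulus_comp_add_right] using
    hid.comp (measurable_pi_apply ((), t))

/-- Reversibility is about time `0`; stationarity moves the centre to `c / 2`, as the increments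
`X (c - s) - X c` are those of the reversed process started at `c`. -/
lemma identDistrib_filterModulus_sub (hXs : HasStationaryIncrements X P)
    (hX : Measurable (Function.uncurry X)) (hXg : LinearGrowth (fun s ω => X s ω - X 0 ω) P)
    (hrev : IdentDistrib (fun ω s => X (-s) ω - X 0 ω) (fun ω s => X s ω - X 0 ω) P P)
    {f : ι → ℝ → ℂ} (hf : ∀ i, HasFirstMoment (f i)) (hf0 : ∀ i, ∫ s, f i s = 0)
    (hfH : ∀ i, ∀ᵐ s, f i (-s) = conj (f i s)) (c : ℝ) :
    IdentDistrib (fun ω (p : ι × ℝ) => filterModulus (f p.1) X (c - p.2) ω)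
      (fun ω p => filterModulus (f p.1) X p.2 ω) P P := by
  have hc := (hXs c).comp (u := fun (x : ℝ → ℝ) s => x (-s)) (by fun_prop)
  have hid := hXg.identDistrib_filterModulus (U := fun s => X (c - s))
    (hX.comp (by fun_prop : Measurable fun p : ℝ × Ω => (c - p.1, p.2)))
    (by simpa only [Function.comp_def, neg_add_eq_sub, sub_zero] using hc.trans hrev) hf hf0
  simpa only [fun p : ι × ℝ => filterModulus_comp_sub_left (hfH p.1) X c p.2] using hid

end HasStationaryIncrements

end Increments

section ScatteringMoments

variable {Ω ι : Type*} [MeasurableSpace Ω] {P : Measure Ω} [IsProbabilityMeasure P]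

namespace LinearGrowth

/-- Independence splits the cross moment, and the constant mean of `M` is then killed by `φ`. -/
lemma integral_convolution_mul_convolution_eq_zero {M N : ℝ → Ω → ℝ} (hM : LinearGrowth M P)
    (hN : LinearGrowth N P) (hind : ∀ p q, IndepFun (M p) (N q) P)
    (hmean : ∀ p, ∫ ω, M p ω ∂P = ∫ ω, M 0 ω ∂P) {φ ρ : ℝ → ℂ} (hφ : HasFirstMoment φ)
    (hφ0 : ∫ s, φ s = 0) (hρ : HasFirstMoment ρ) (t : ℝ) :
    ∫ ω, ((fun s => M s ω) ⋆ φ) t * ((fun s => N s ω) ⋆ ρ) t ∂P = 0 := by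
  have hMφ := hM.isL2Integrable_smul (hφ.comp_sub_left t)
  have hNρ := hN.isL2Integrable_smul (hρ.comp_sub_left t)
  have hsplit (z : ℝ × ℝ) : ∫ ω, (M z.1 ω • φ (t - z.1)) * (N z.2 ω • ρ (t - z.2)) ∂P =
      (∫ ω, M 0 ω ∂P) • φ (t - z.1) * ((∫ ω, N z.2 ω ∂P) • ρ (t - z.2)) := by
    simp only [smul_mul_smul_comm]
    rw [integral_smul_const, ← hmean z.1]
    congr 1
    exact (hind z.1 z.2).integral_fun_mul_eq_mul_integral
      (hM.measurable.of_uncurry_left).aestronglyMeasurable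
      (hN.measurable.of_uncurry_left).aestronglyMeasurable
  calc ∫ ω, ((fun s => M s ω) ⋆ φ) t * ((fun s => N s ω) ⋆ ρ) t ∂P
      = ∫ z : ℝ × ℝ, (∫ ω, (M z.1 ω • φ (t - z.1)) * (N z.2 ω • ρ (t - z.2)) ∂P)
          ∂(volume : Measure ℝ).prod volume := hMφ.integral_mul_integral hNρ
    _ = (∫ p, (∫ ω, M 0 ω ∂P) • φ (t - p)) * ∫ q, (∫ ω, N q ω ∂P) • ρ (t - q) := by
        simp only [hsplit]
        exact integral_prod_mul (μ := volume) (ν := volume) (fun p => (∫ ω, M 0 ω ∂P) • φ (t - p))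
          fun q => (∫ ω, N q ω ∂P) • ρ (t - q)
    _ = 0 := by rw [integral_smul, integral_comp_sub_left_eq_zero hφ0, smul_zero, zero_mul]

/-- Reversing the processes about `t` conjugates their convolutions with `φ` at time `t`. -/
lemma im_integral_convolution_mul_conj_eq_zero {M : ι → ℝ → Ω → ℝ}
    (hM : ∀ i, LinearGrowth (M i) P) {φ : ℝ → ℂ} (hφ : HasFirstMoment φ)
    (hφH : ∀ᵐ s, φ (-s) = conj (φ s)) (t : ℝ)
    (hrev : IdentDistrib (fun ω (p : ι × ℝ) => M p.1 (t + t - p.2) ω)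
      (fun ω p => M p.1 p.2 ω) P P) (i j : ι) :
    (∫ ω, ((fun s => M i s ω) ⋆ φ) t * conj (((fun s => M j s ω) ⋆ φ) t) ∂P).im = 0 := by
  have hMr (i) : LinearGrowth (fun s => M i (t + t - s)) P :=
    (hM i).of_identDistrib ((hM i).measurable.comp
      (by fun_prop : Measurable fun p : ℝ × Ω => (t + t - p.1, p.2)))
      fun s => hrev.comp (measurable_pi_apply (i, s))
  have hmoment := ((identDistrib_convolution hMr hM (fun _ => hφ) hrev).comp
    (u := fun x : ι × ℝ → ℂ => x (i, t) * conj (x (j, t))) (by fun_prop)).integral_eq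
  have hreflect (i : ι) (ω : Ω) :
      ((fun s => M i (t + t - s) ω) ⋆ φ) t = conj (((fun s => M i s ω) ⋆ φ) t) := by
    rw [convolution_comp_sub_left_eq_conj hφH fun s => M i s ω, add_sub_cancel_left]
  simp only [Function.comp_apply, hreflect] at hmoment
  rw [← Complex.conj_eq_iff_im, ← integral_conj, ← hmoment]
  simp only [map_mul]

end LinearGrowth

end ScatteringMoments

section Dilations

variable {ψ : ℝ → ℂ}

protected lemma HasFirstMoment.dilate (hψ : HasFirstMoment ψ) (j : ℤ) :
    HasFirstMoment (dilate ψ j) := by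
  have ha : (0 : ℝ) < 2 ^ (-j) := by positivity
  have hmeas : StronglyMeasurable (Scattering.dilate ψ j) :=
    (hψ.stronglyMeasurable.comp_measurable (measurable_const_mul _)).const_mul _
  have hψint := (iff_integrable hψ.stronglyMeasurable).1 hψ
  refine (iff_integrable hmeas).2 (((hψint.comp_mul_left' ha.ne').const_mul
    ((2 ^ (-j)) * (1 + (2 ^ (-j))⁻¹))).mono' ?_ (.of_forall fun t => ?_))
  · exact (by fun_prop : Measurable fun s : ℝ => 1 + |s|).aestronglyMeasurable.mul
      hmeas.norm.aestronglyMeasurable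
  · have hweight : 1 + |t| ≤ (1 + (2 ^ (-j) : ℝ)⁻¹) * (1 + |2 ^ (-j) * t|) := by
      rw [abs_mul, abs_of_pos ha, add_mul, one_mul, mul_add, inv_mul_cancel_left₀ ha.ne']
      linarith [mul_nonneg ha.le (abs_nonneg t), inv_nonneg.2 ha.le]
    rw [Real.norm_of_nonneg (by positivity)]
    calc (1 + |t|) * ‖Scattering.dilate ψ j t‖
        = (1 + |t|) * (2 ^ (-j) * ‖ψ (2 ^ (-j) * t)‖) := by
          rw [Scattering.dilate, norm_mul, Complex.norm_real, Real.norm_of_nonneg ha.le]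
      _ ≤ (1 + (2 ^ (-j))⁻¹) * (1 + |2 ^ (-j) * t|) * (2 ^ (-j) * ‖ψ (2 ^ (-j) * t)‖) := by
          gcongr
      _ = _ := by ring

lemma angularFourier_dilate (ψ : ℝ → ℂ) (j : ℤ) (ω : ℝ) :
    angularFourier (dilate ψ j) ω = angularFourier ψ (2 ^ j * ω) := by
  have ha : (0 : ℝ) < 2 ^ (-j) := by positivity
  have hexp (t : ℝ) : Complex.I * (ω : ℂ) * t =
      Complex.I * ((2 ^ j * ω : ℝ) : ℂ) * ((2 ^ (-j) * t : ℝ) : ℂ) := by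
    have hinv : (2 : ℂ) ^ j * 2 ^ (-j) = 1 := by rw [← zpow_add₀ two_ne_zero]; simp
    push_cast
    linear_combination (-(Complex.I * ω * t)) * hinv
  simp only [angularFourier, dilate, hexp, mul_assoc (((2 : ℝ) ^ (-j) : ℝ) : ℂ)]
  rw [integral_const_mul, Measure.integral_comp_mul_left fun s : ℝ =>
      ψ s * Complex.exp (-(Complex.I * ((2 ^ j * ω : ℝ) : ℂ) * (s : ℂ))),
    abs_of_pos (inv_pos.2 ha), ← Complex.real_smul, smul_inv_smul₀ ha.ne']

lemma angularFourier_zero (f : ℝ → ℂ) : angularFourier f 0 = ∫ t, f t := by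
  simp [angularFourier]

lemma integral_dilate (hψ : ∫ t, ψ t = 0) (j : ℤ) : ∫ t, dilate ψ j t = 0 := by
  rw [← angularFourier_zero, angularFourier_dilate, mul_zero, angularFourier_zero, hψ]

lemma ae_dilate_neg_eq_conj (hψ : HasFirstMoment ψ)
    (hreal : ∀ ω, (angularFourier ψ ω).im = 0) (j : ℤ) :
    ∀ᵐ t, dilate ψ j (-t) = conj (dilate ψ j t) :=
  ae_comp_neg_eq_conj (hψ.dilate j).integrable fun ω => by rw [angularFourier_dilate, hreal]

lemma IsAnalyticWavelet.angularFourier_dilate_mul_neg (hψa : IsAnalyticWavelet ψ)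
    (hψ0 : ∫ t, ψ t = 0) (j l : ℤ) (ω : ℝ) :
    angularFourier (dilate ψ j) ω * angularFourier (dilate ψ l) (-ω) = 0 := by
  have hvanish (i : ℤ) {ξ : ℝ} (hξ : ξ ≤ 0) : angularFourier (dilate ψ i) ξ = 0 := by
    rcases hξ.lt_or_eq with hneg | rfl
    · rw [angularFourier_dilate]
      exact hψa _ (mul_neg_of_pos_of_neg (by positivity) hneg)
    · rw [angularFourier_zero, integral_dilate hψ0]
  rcases le_total ω 0 with hω | hω
  · rw [hvanish j hω, zero_mul]
  · rw [hvanish l (neg_nonpos.2 hω), mul_zero]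

end Dilations

namespace LinearGrowth

variable {Ω E : Type*} [MeasurableSpace Ω] {P : Measure Ω} [SFinite P]
  [NormedAddCommGroup E] [NormedSpace ℝ E] {X : ℝ → Ω → ℝ} {f : ℝ → E}

lemma ae_convolutionExistsAt_of_sub (hX : LinearGrowth (fun s ω => X s ω - X 0 ω) P)
    (hf : HasFirstMoment f) (t : ℝ) :
    ∀ᵐ ω ∂P, ConvolutionExistsAt (fun s => X s ω) f t (ContinuousLinearMap.lsmul ℝ ℝ) volume := by
  filter_upwards [hX.ae_convolutionExistsAt hf t] with ω hω
  have hconst : Integrable fun s => X 0 ω • f (t - s) := (hf.integrable.comp_sub_left t).smul _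
  refine (hω.add hconst).congr (.of_forall fun s => ?_)
  simp

lemma memLp_convolution_of_sub (hX : LinearGrowth (fun s ω => X s ω - X 0 ω) P)
    (hf : HasFirstMoment f) (hf0 : ∫ s, f s = 0) (t : ℝ) :
    MemLp (fun ω => ((fun s => X s ω) ⋆ f) t) 2 P := by
  simpa only [convolution_sub_const hf.integrable hf0] using hX.memLp_convolution hf t

lemma filterModulus_of_sub (hX : LinearGrowth (fun s ω => X s ω - X 0 ω) P)
    (hf : HasFirstMoment f) (hf0 : ∫ s, f s = 0) :
    LinearGrowth (Scattering.filterModulus f X) P := by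
  simpa only [filterModulus_sub_const hf.integrable hf0] using hX.filterModulus hf

end LinearGrowth

section WaveletProcesses

variable {Ω : Type*} [MeasurableSpace Ω] {P : Measure Ω} {ψ : ℝ → ℂ} {X : ℝ → Ω → ℝ}

lemma LinearGrowth.isWellDefined [SFinite P] (hX : LinearGrowth (fun s ω => X s ω - X 0 ω) P)
    (hψ : HasFirstMoment ψ) (hψ0 : ∫ t, ψ t = 0) : IsWellDefined ψ X P := by
  refine ⟨fun j t => ?_, fun j k t => ?_⟩
  · exact ⟨hX.ae_convolutionExistsAt_of_sub (hψ.dilate j) t,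
      hX.memLp_convolution_of_sub (hψ.dilate j) (integral_dilate hψ0 j) t⟩
  · have hmod := hX.filterModulus_of_sub (hψ.dilate j) (integral_dilate hψ0 j)
    exact ⟨hmod.ae_convolutionExistsAt (hψ.dilate k) t, hmod.memLp_convolution (hψ.dilate k) t⟩

lemma HasStationaryIncrements.linearGrowth [SFinite P] (hXs : HasStationaryIncrements X P)
    (hX : Measurable (Function.uncurry X)) (hX2 : ∀ s t, MemLp (fun ω => X t ω - X s ω) 2 P) :
    LinearGrowth (fun s ω => X s ω - X 0 ω) P :=
  (hXs.isStationaryIncrementProcess hX hX2).linearGrowth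

lemma HasStationaryIncrements.integral_convolution_filterModulus_eq_zero
    (hXs : HasStationaryIncrements X P) (hX : Measurable (Function.uncurry X))
    (hX2 : ∀ s t, MemLp (fun ω => X t ω - X s ω) 2 P)
    (hG : IsGaussianProcess (fun t ω => X t ω - X 0 ω) P) {f g φ : ℝ → ℂ} (hf : HasFirstMoment f)
    (hg : HasFirstMoment g) (hφ : HasFirstMoment φ) (hf0 : ∫ s, f s = 0) (hg0 : ∫ s, g s = 0)
    (hφ0 : ∫ s, φ s = 0) (hfg : ∀ ω, angularFourier f ω * angularFourier g ω = 0)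
    (hfg' : ∀ ω, angularFourier f ω * angularFourier g (-ω) = 0) (t : ℝ) :
    ∫ ω, ((fun s => filterModulus f X s ω) ⋆ φ) t *
      conj (((fun s => filterModulus g X s ω) ⋆ φ) t) ∂P = 0 := by
  have := hG.isProbabilityMeasure
  have hXg := hXs.linearGrowth hX hX2
  have hind := (hXs.isStationaryIncrementProcess hX hX2).indepFun_filterModulus hG hf hg hf0 hg0
    hfg hfg'
  simp only [filterModulus_sub_const hf.integrable hf0,
    filterModulus_sub_const hg.integrable hg0] at hind
  have hmean (p : ℝ) : ∫ ω, filterModulus f X p ω ∂P = ∫ ω, filterModulus f X 0 ω ∂P := by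
    simpa using (hXs.identDistrib_filterModulus_add hX hXg hf hf0 p 0).integral_eq
  simp only [← convolution_conj]
  exact (hXg.filterModulus_of_sub hf hf0).integral_convolution_mul_convolution_eq_zero
    (hXg.filterModulus_of_sub hg hg0) hind hmean hφ hφ0 hφ.star t

lemma HasStationaryIncrements.im_integral_convolution_filterModulus_eq_zero {ι : Type*}
    [IsProbabilityMeasure P] (hXs : HasStationaryIncrements X P)
    (hX : Measurable (Function.uncurry X)) (hX2 : ∀ s t, MemLp (fun ω => X t ω - X s ω) 2 P)
    (hrev : IdentDistrib (fun ω s => X (-s) ω - X 0 ω) (fun ω s => X s ω - X 0 ω) P P)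
    {f : ι → ℝ → ℂ} {φ : ℝ → ℂ} (hf : ∀ i, HasFirstMoment (f i)) (hf0 : ∀ i, ∫ s, f i s = 0)
    (hfH : ∀ i, ∀ᵐ s, f i (-s) = conj (f i s)) (hφ : HasFirstMoment φ)
    (hφH : ∀ᵐ s, φ (-s) = conj (φ s)) (i j : ι) (t : ℝ) :
    (∫ ω, ((fun s => filterModulus (f i) X s ω) ⋆ φ) t *
      conj (((fun s => filterModulus (f j) X s ω) ⋆ φ) t) ∂P).im = 0 := by
  have hXg := hXs.linearGrowth hX hX2
  exact LinearGrowth.im_integral_convolution_mul_conj_eq_zero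
    (M := fun i => filterModulus (f i) X) (fun i => hXg.filterModulus_of_sub (hf i) (hf0 i)) hφ hφH
    t (hXs.identDistrib_filterModulus_sub hX hXg hrev hf hf0 hfH (t + t)) i j

end WaveletProcesses

end Scattering

open Scattering in
theorem mainTheorem3_general {Ω : Type*} [MeasurableSpace Ω] {P : Measure Ω}
    [IsProbabilityMeasure P] {ψ : ℝ → ℂ} (hψ : HasFirstMoment ψ) (hψ0 : ∫ t, ψ t = 0)
    {X : ℝ → Ω → ℝ} (hX : Measurable (Function.uncurry X))
    (hX2 : ∀ s t, MemLp (fun ω => X t ω - X s ω) 2 P) (hXs : HasStationaryIncrements X P) :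
    IsWellDefined ψ X P ∧
    (IsAnalyticWavelet ψ → IsGaussianProcess (fun t ω => X t ω - X 0 ω) P → ∀ j a : ℤ,
      (∀ ω, angularFourier (dilate ψ j) ω * angularFourier (dilate ψ (j - a)) ω = 0) →
      ∀ (b : ℤ) (t : ℝ), crossSpectrum ψ X P j a b t = 0) ∧
    ((∀ ω, (angularFourier ψ ω).im = 0) →
      IdentDistrib (fun ω t => X (-t) ω - X 0 ω) (fun ω t => X t ω - X 0 ω) P P →
      ∀ (j a b : ℤ) (t : ℝ), (crossSpectrum ψ X P j a b t).im = 0) := by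
  refine ⟨(hXs.linearGrowth hX hX2).isWellDefined hψ hψ0, ?_, ?_⟩
  · intro hψa hG j a hja b t
    refine div_eq_zero_iff.2 (.inl ?_)
    exact hXs.integral_convolution_filterModulus_eq_zero hX hX2 hG (hψ.dilate j)
      (hψ.dilate (j - a)) (hψ.dilate (j - b)) (integral_dilate hψ0 _) (integral_dilate hψ0 _)
      (integral_dilate hψ0 _) hja (hψa.angularFourier_dilate_mul_neg hψ0 j (j - a)) t
  · intro hreal hrev j a b t
    rw [crossSpectrum, Complex.div_ofReal_im, div_eq_zero_iff]
    left
    exact hXs.im_integral_convolution_filterModulus_eq_zero hX hX2 hrev hψ.dilate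
      (integral_dilate hψ0) (ae_dilate_neg_eq_conj hψ hreal) (hψ.dilate (j - b))
      (ae_dilate_neg_eq_conj hψ hreal (j - b)) j (j - a) t

theorem mainTheorem3 {Ω : Type*} [MeasurableSpace Ω] (P : Measure Ω) [IsProbabilityMeasure P]
    (ψ : ℝ → ℂ) (hψ : Scattering.IsWavelet ψ)
    (X : ℝ → Ω → ℝ) (hX : Measurable (Function.uncurry X))
    (hX2 : ∀ s t : ℝ, MemLp (fun ω => X t ω - X s ω) 2 P)
    (hXs : Scattering.HasStationaryIncrements X P) :
    Scattering.IsWellDefined ψ X P ∧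
    (Scattering.IsAnalyticWavelet ψ → IsGaussianProcess X P →
      ∀ j a : ℤ,
        (∀ ω : ℝ, Scattering.angularFourier (Scattering.dilate ψ j) ω *
          Scattering.angularFourier (Scattering.dilate ψ (j - a)) ω = 0) →
        ∀ (b : ℤ) (t : ℝ), Scattering.crossSpectrum ψ X P j a b t = 0) ∧
    (Scattering.IsTimeReversible X P →
      ∀ (j a b : ℤ) (t : ℝ), (Scattering.crossSpectrum ψ X P j a b t).im = 0) := by
  have hψ1 := (Scattering.HasFirstMoment.iff_integrable hψ.measurable.stronglyMeasurable).2 hψ.decay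
  obtain ⟨hwell, hgauss, hreversal⟩ := mainTheorem3_general hψ1 hψ.zero_average hX hX2 hXs
  refine ⟨hwell, fun hψa hG => hgauss hψa ?_, fun hrev => hreversal hψ.real_fourier ?_⟩
  · simpa using hG.shift 0
  · simpa [Function.comp_def] using hrev.comp (u := fun (x : ℝ → ℝ) t => x t - x 0) (by fun_prop)
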